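/- Let $\mathfrak g$ be the complex simple Lie algebra of type $D_4$, with a Cartan subalgebra $\mathfrak h$ and a system $S$ of simple roots; let $\Delta$ be the set of roots, $\gamma$ the highest root, and $H_\alpha$ the coroot of $\alpha\in\Delta$. Let $\mathfrak q=\mathfrak l\oplus\mathfrak n$ be the Heisenberg parabolic subalgebra, i.e. the standard parabolic subalgebra that corresponds to $\{\alpha\in S : (\alpha,\gamma)=0\}$, and let $\mathfrak g=\mathfrak z(\bar{\mathfrak n})\oplus V^-\oplus\mathfrak l\oplus V^+\oplus\mathfrak z(\mathfrak n)$ be the decomposition of $\mathfrak g$ into the eigenspaces of $\operatorname{ad}(H_\gamma)$ for the eigenvalues $-2,-1,0,1,2$, so that $\mathfrak n=V^+\oplus\mathfrak z(\mathfrak n)$ and $\mathfrak z(\mathfrak n)=\mathfrak g_\gamma$. Let $\Delta(V^+)$ be the set of roots $\alpha$ with $\mathfrak g_\alpha\subset V^+$. Choose root vectors $X_{\pm\alpha}\in\mathfrak g_{\pm\alpha}$ for $\alpha\in\Delta(V^+)\cup\{\gamma\}$ with $[X_\alpha,X_{-\alpha}]=H_\alpha$. Let $d\chi$ be the character of $\mathfrak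 q$ with $[Y,X_\gamma]=d\chi(Y)X_\gamma$ for $Y\in\mathfrak q$, let $\mathbb C_{-d\chi}$ be the one-dimensional $\mathfrak q$-module on which $Y\in\mathfrak q$ acts by $-d\chi(Y)$, and let $$M(\mathbb C_{-d\chi})=\mathcal U(\mathfrak g)\otimes_{\mathcal U(\mathfrak q)}\mathbb C_{-d\chi}.$$ Let $\langle\cdot,\cdot\rangle$ be the alternating form on $V^+$ with $[U,W]=\langle U,W\rangle X_\gamma$. For $Z\in[\mathfrak l,\mathfrak l]$ put $$\omega_2(Z)=-\tfrac12\sum_{\alpha,\beta\in\Delta(V^+)}\langle X_\beta,[Z,X_\alpha]\rangle\,X_{-\alpha}X_{-\beta}\in\mathcal U(\bar{\mathfrak n}),$$ extend $\omega_2$ linearly to $\mathfrak l=[\mathfrak l,\mathfrak l]\oplus\mathbb C H_\gamma$ by $\omega_2(H_\gamma)=0$, and for $Y\in V^-$ put $$\omega_3(Y)=\sum_{\varepsilon\in\Delta(V^+)}X_{-\varepsilon}\,\omega_2([X_\varepsilon,Y])\in\mathcal U(\bar{\mathfrak n}).$$ Let $E\subset M(\mathbb C_{-d\chi})$ be the complex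 span of the elements $\omega_3(Y)\otimes 1$, $Y\in V^-$. Then: 1. $E$ is a $\mathfrak q$-submodule of $M(\mathbb C_{-d\chi})$ with $\dim E>1$, and $\mathfrak n$ annihilates $E$. 2. There is a non-zero $\mathcal U(\mathfrak g)$-homomorphism $\mathcal U(\mathfrak g)\otimes_{\mathcal U(\mathfrak q)}E\to M(\mathbb C_{-d\chi})$, given by $u\otimes m\mapsto u\cdot m$, from this non-scalar generalized Verma module. 3. The generalized Verma module $M(\mathbb C_{-d\chi})$ is reducible: it has a $\mathcal U(\mathfrak g)$-submodule other than $0$ and itself. -/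

import Mathlib

open scoped TensorProduct

noncomputable section

/-! ### Generalized Verma modules -/

/-- The relations `u a ⊗ f - u ⊗ a f` (`u ∈ U(g)`, `a ∈ q`, `f ∈ F`) that turn `U(g) ⊗_ℂ F` into
`U(g) ⊗_{U(q)} F`; they suffice because `U(q)` is generated by `q`. -/
def genVermaRel {g : Type*} [LieRing g] [LieAlgebra ℂ g] (q : LieSubalgebra ℂ g)
    (F : Type*) [AddCommGroup F] [Module ℂ F] [LieRingModule q F] [LieModule ℂ q F] :
    Submodule (UniversalEnvelopingAlgebra ℂ g) (UniversalEnvelopingAlgebra ℂ g ⊗[ℂ] F) :=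
  Submodule.span (UniversalEnvelopingAlgebra ℂ g)
    {t | ∃ (u : UniversalEnvelopingAlgebra ℂ g) (a : q) (f : F),
      t = (u * UniversalEnvelopingAlgebra.ι ℂ (a : g)) ⊗ₜ[ℂ] f - u ⊗ₜ[ℂ] ⁅a, f⁆}

/-- The generalized Verma module `U(g) ⊗_{U(q)} F` induced from a `q`-module `F`. -/
def GenVerma {g : Type*} [LieRing g] [LieAlgebra ℂ g] (q : LieSubalgebra ℂ g)
    (F : Type*) [AddCommGroup F] [Module ℂ F] [LieRingModule q F] [LieModule ℂ q F] : Type _ :=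
  (UniversalEnvelopingAlgebra ℂ g ⊗[ℂ] F) ⧸ genVermaRel q F

namespace GenVerma

attribute [local instance] LieRing.ofAssociativeRing

variable {g : Type*} [LieRing g] [LieAlgebra ℂ g] (q : LieSubalgebra ℂ g)
  (F : Type*) [AddCommGroup F] [Module ℂ F] [LieRingModule q F] [LieModule ℂ q F]

instance : AddCommGroup (GenVerma q F) :=
  inferInstanceAs (AddCommGroup ((UniversalEnvelopingAlgebra ℂ g ⊗[ℂ] F) ⧸ genVermaRel q F))

instance : Module (UniversalEnvelopingAlgebra ℂ g) (GenVerma q F) :=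
  inferInstanceAs (Module (UniversalEnvelopingAlgebra ℂ g)
    ((UniversalEnvelopingAlgebra ℂ g ⊗[ℂ] F) ⧸ genVermaRel q F))

instance : Module ℂ (GenVerma q F) :=
  inferInstanceAs (Module ℂ ((UniversalEnvelopingAlgebra ℂ g ⊗[ℂ] F) ⧸ genVermaRel q F))

instance : IsScalarTower ℂ (UniversalEnvelopingAlgebra ℂ g) (GenVerma q F) :=
  inferInstanceAs (IsScalarTower ℂ (UniversalEnvelopingAlgebra ℂ g)
    ((UniversalEnvelopingAlgebra ℂ g ⊗[ℂ] F) ⧸ genVermaRel q F))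

/-- The action of `g` on `U(g) ⊗_{U(q)} F` by left multiplication. -/
instance : LieRingModule g (GenVerma q F) where
  bracket x m := UniversalEnvelopingAlgebra.ι ℂ x • m
  add_lie x y m := by
    change UniversalEnvelopingAlgebra.ι ℂ (x + y) • m = _
    rw [map_add, add_smul]
  lie_add x m n := smul_add _ m n
  leibniz_lie x y m := by
    change UniversalEnvelopingAlgebra.ι ℂ x • UniversalEnvelopingAlgebra.ι ℂ y • m =
      UniversalEnvelopingAlgebra.ι ℂ ⁅x, y⁆ • m +
        UniversalEnvelopingAlgebra.ι ℂ y • UniversalEnvelopingAlgebra.ι ℂ x • m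
    rw [LieHom.map_lie, LieRing.of_associative_ring_bracket, sub_smul, mul_smul, mul_smul,
      sub_add_cancel]

instance : LieModule ℂ g (GenVerma q F) where
  smul_lie t x m := by
    change UniversalEnvelopingAlgebra.ι ℂ (t • x) • m = t • UniversalEnvelopingAlgebra.ι ℂ x • m
    rw [map_smul, smul_assoc]
  lie_smul t x m := by
    change UniversalEnvelopingAlgebra.ι ℂ x • t • m = t • UniversalEnvelopingAlgebra.ι ℂ x • m
    rw [← algebraMap_smul (UniversalEnvelopingAlgebra ℂ g) t m, smul_smul,
      ← Algebra.commutes, mul_smul, algebraMap_smul]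

variable {F}

/-- The element `u ⊗ f` of `U(g) ⊗_{U(q)} F`. -/
def mk (u : UniversalEnvelopingAlgebra ℂ g) (f : F) : GenVerma q F :=
  Submodule.Quotient.mk (p := genVermaRel q F) (u ⊗ₜ[ℂ] f)

end GenVerma

/-- The one-dimensional `q`-module `ℂ_{sλ}`: the space `ℂ`, with `a ∈ q` acting by `s λ(a)`. -/
def ScalarModule {g : Type*} [LieRing g] [LieAlgebra ℂ g] {q : LieSubalgebra ℂ g}
    (_s : ℂ) (_lam : LieAlgebra.LieCharacter ℂ q) : Type := ℂ

namespace ScalarModule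

variable {g : Type*} [LieRing g] [LieAlgebra ℂ g] {q : LieSubalgebra ℂ g}
  (s : ℂ) (lam : LieAlgebra.LieCharacter ℂ q)

instance : AddCommGroup (ScalarModule s lam) := inferInstanceAs (AddCommGroup ℂ)

instance : Module ℂ (ScalarModule s lam) := inferInstanceAs (Module ℂ ℂ)

/-- The vector `1` of `ℂ_{sλ}`. -/
def one : ScalarModule s lam := (1 : ℂ)

instance : LieRingModule q (ScalarModule s lam) where
  bracket a z := (s * lam a) • z
  add_lie a b z := by
    change (s * lam (a + b)) • z = (s * lam a) • z + (s * lam b) • z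
    rw [map_add, mul_add, add_smul]
  lie_add a z w := smul_add _ z w
  leibniz_lie a b z := by
    change (s * lam a) • (s * lam b) • z =
      (s * lam ⁅a, b⁆) • z + (s * lam b) • (s * lam a) • z
    rw [LieAlgebra.lieCharacter_apply_lie, mul_zero, zero_smul, zero_add, smul_comm]

instance : LieModule ℂ q (ScalarModule s lam) where
  smul_lie t a z := by
    change (s * lam (t • a)) • z = t • (s * lam a) • z
    rw [map_smul, smul_smul, smul_eq_mul, mul_left_comm]
  lie_smul t a z := smul_comm _ t z

end ScalarModule

/-! ### The Heisenberg parabolic subalgebra in type `D₄`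

Throughout, `b : LieAlgebra.Basis (Fin 4) H` is a system of Chevalley generators `e i`, `f i`, `h i`
of `g` (so `H` is a Cartan subalgebra, with simple root vectors `e i ∈ g_{α_i}`), whose Cartan
matrix `b.A` is going to be `CartanMatrix.D 4`; there the node `1` is the trivalent one. The highest
root is `γ = α₀ + 2 α₁ + α₂ + α₃`. -/

namespace HeisenbergD4

attribute [local instance] LieRing.ofAssociativeRing

variable {g : Type*} [LieRing g] [LieAlgebra ℂ g] {H : LieSubalgebra ℂ g}
  (b : LieAlgebra.Basis (Fin 4) H)

/-- `H_γ`, the coroot of the highest root `γ`. -/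
def Hgamma : g := b.h 0 + (2 : ℂ) • b.h 1 + b.h 2 + b.h 3

/-- `g(k)`, the eigenspace of `ad H_γ` for the eigenvalue `k`. -/
def grade (k : ℤ) : Submodule ℂ g :=
  Module.End.eigenspace (LieAlgebra.ad ℂ g (Hgamma b)) (k : ℂ)

/-- The Heisenberg parabolic subalgebra `q`: the standard parabolic subalgebra that corresponds to
the set of simple roots `α` with `(α, γ) = 0`, that is `α(H_γ) = 0`. It is generated by the
Cartan subalgebra, all the `g_α` with `α` simple, and the `g_{-α}` with `α` in that set. -/
def q : LieSubalgebra ℂ g :=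
  LieSubalgebra.lieSpan ℂ g
    ((H : Set g) ∪ Set.range b.e ∪ {x | ∃ i, ⁅Hgamma b, b.e i⁆ = 0 ∧ x = b.f i})

/-- The nilradical `n = V⁺ ⊕ z(n)` of `q`, with `V⁺ = g(1)` and `z(n) = g(2) = g_γ`. -/
def n : Submodule ℂ g := grade b 1 ⊔ grade b 2

/-- The multiple of the Killing form for which `(γ, γ) = 2`, that is `B(H_γ, H_γ) = 2`. -/
def B : LinearMap.BilinForm ℂ g :=
  (2 / killingForm ℂ g (Hgamma b) (Hgamma b)) • killingForm ℂ g

section character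

variable {b}

lemma lie_mem_grade {x y : g} {i j : ℤ} (hx : x ∈ grade b i) (hy : y ∈ grade b j) :
    ⁅x, y⁆ ∈ grade b (i + j) := by
  simp only [grade, Module.End.mem_eigenspace_iff, LieAlgebra.ad_apply] at *
  rw [leibniz_lie, hx, hy, smul_lie, lie_smul, ← add_smul]
  push_cast
  rfl

lemma lie_e (hA : b.A = CartanMatrix.D 4) (i : Fin 4) :
    ⁅Hgamma b, b.e i⁆ = (if i = 1 then (1 : ℂ) else 0) • b.e i := by
  simp only [Hgamma, add_lie, smul_lie, b.lie_h_e, hA]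
  fin_cases i <;> simp [CartanMatrix.D] <;> module

lemma lie_f (hA : b.A = CartanMatrix.D 4) (i : Fin 4) :
    ⁅Hgamma b, b.f i⁆ = (if i = 1 then (-1 : ℂ) else 0) • b.f i := by
  simp only [Hgamma, add_lie, smul_lie, b.lie_h_f, hA]
  fin_cases i <;> simp [CartanMatrix.D] <;> module

lemma mem_grade_of_mem_q (hA : b.A = CartanMatrix.D 4) {x : g} (hx : x ∈ q b) :
    x ∈ ⨆ k : ℕ, grade b (k : ℤ) := by
  have le (k : ℕ) {y : g} (hy : y ∈ grade b (k : ℤ)) : y ∈ ⨆ k : ℕ, grade b (k : ℤ) :=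
    (le_iSup (fun k : ℕ ↦ grade b (k : ℤ)) k) hy
  induction hx using LieSubalgebra.lieSpan_induction with
  | mem u hu =>
    rcases hu with (hu | ⟨i, rfl⟩) | ⟨i, hi, rfl⟩
    · refine le 0 ?_
      simp only [grade, Module.End.mem_eigenspace_iff, LieAlgebra.ad_apply, Nat.cast_zero,
        Int.cast_zero, zero_smul]
      have hu' : u ∈ Submodule.span ℂ (Set.range b.h) := by
        rw [← b.coe_cartan_eq_span]; exact hu
      induction hu' using Submodule.span_induction with
      | mem v hv => obtain ⟨j, rfl⟩ := hv; simp [Hgamma, b.lie_h_h]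
      | zero => simp
      | add v w hv hw hv' hw' =>
        rw [← b.coe_cartan_eq_span] at hv hw
        rw [lie_add, hv' hv, hw' hw, add_zero]
      | smul t v hv hv' =>
        rw [← b.coe_cartan_eq_span] at hv
        rw [lie_smul, hv' hv, smul_zero]
    · by_cases h : i = 1
      · refine le 1 ?_
        simp [grade, lie_e hA, h]
      · refine le 0 ?_
        simp [grade, lie_e hA, h]
    · have h : i ≠ 1 := by
        rintro rfl
        rw [lie_e hA] at hi
        exact (b.sl2 1).e_ne_zero (by simpa using hi)
      refine le 0 ?_
      simp [grade, lie_f hA, h]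
  | zero => exact zero_mem _
  | add u v _ _ hu hv => exact add_mem hu hv
  | smul t u _ hu => exact Submodule.smul_mem _ t hu
  | lie u v hu' hv' hu hv =>
    clear hu' hv'
    induction hu using Submodule.iSup_induction' with
    | zero => simp
    | add u u' _ _ h h' => rw [add_lie]; exact add_mem h h'
    | mem i u hu =>
      induction hv using Submodule.iSup_induction' with
      | zero => simp
      | add v v' _ _ h h' => rw [lie_add]; exact add_mem h h'
      | mem j v hv =>
        refine le (i + j) ?_
        push_cast
        exact lie_mem_grade hu hv

lemma killingForm_lie_Hgamma {x y : g} (hx : x ∈ ⨆ k : ℕ, grade b (k : ℤ))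
    (hy : y ∈ ⨆ k : ℕ, grade b (k : ℤ)) : killingForm ℂ g ⁅x, y⁆ (Hgamma b) = 0 := by
  induction hx using Submodule.iSup_induction' with
  | zero => simp
  | add u u' _ _ h h' => rw [add_lie, map_add, LinearMap.add_apply, h, h', add_zero]
  | mem i x hx =>
    induction hy using Submodule.iSup_induction' with
    | zero => simp
    | add v v' _ _ h h' => rw [lie_add, map_add, LinearMap.add_apply, h, h', add_zero]
    | mem j y hy =>
      simp only [grade, Module.End.mem_eigenspace_iff, LieAlgebra.ad_apply, Int.cast_natCast]
        at hx hy
      have h1 : killingForm ℂ g ⁅x, y⁆ (Hgamma b) = -((j : ℂ) * killingForm ℂ g x y) := by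
        rw [killingForm, LieModule.traceForm_apply_lie_apply, ← lie_skew, hy]
        simp
      have h2 : killingForm ℂ g ⁅x, y⁆ (Hgamma b) = (i : ℂ) * killingForm ℂ g x y := by
        rw [killingForm, LieModule.traceForm_comm, ← LieModule.traceForm_apply_lie_apply, hx]
        simp
      by_cases hij : (i : ℂ) + j = 0
      · have : i + j = 0 := by exact_mod_cast hij
        obtain rfl : i = 0 := by omega
        simpa using h2
      · have h3 : ((i : ℂ) + j) * killingForm ℂ g x y = 0 := by linear_combination h1 - h2
        rw [h2, (mul_eq_zero.mp h3).resolve_left hij, mul_zero]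

end character

/-- The character `dχ` of `q`, that is the differential of the character `χ` by which the Levi
subgroup acts on `g_γ = z(n)`: with `X_γ`, `X_{-γ}` as below,
`⁅Y, X_γ⁆ = B(⁅Y, X_γ⁆, X_{-γ}) X_γ = B(Y, H_γ) X_γ` for `Y ∈ q`. -/
def dchi (hA : b.A = CartanMatrix.D 4) : LieAlgebra.LieCharacter ℂ (q b) where
  toFun y := B b (y : g) (Hgamma b)
  map_add' x y := by simp
  map_smul' t x := by simp
  map_lie' {x y} := by
    have h := killingForm_lie_Hgamma (mem_grade_of_mem_q hA x.2) (mem_grade_of_mem_q hA y.2)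
    simp [B, h, LieRing.of_associative_ring_bracket, mul_comm]

/-! ### The elements `ω₂` and `ω₃` -/

/-- The roots in `Δ(V⁺)` are `ε = α₁ + (a subset of the three simple roots α₀, α₂, α₃)`. -/
abbrev RootIdx := Bool × Bool × Bool

/-- `ad x` if `c` holds, and the identity otherwise. -/
def adIf (c : Bool) (x : g) : g →ₗ[ℂ] g := if c then LieAlgebra.ad ℂ g x else LinearMap.id

/-- The root vectors `X_ε`, `ε ∈ Δ(V⁺)`. -/
def X (ε : RootIdx) : g :=
  adIf ε.1 (b.e 0) (adIf ε.2.1 (b.e 2) (adIf ε.2.2 (b.e 3) (b.e 1)))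

/-- The sign `(-1)^k`, where `k + 1` is the height of the root `ε`. -/
def sign (ε : RootIdx) : ℂ :=
  (if ε.1 then -1 else 1) * (if ε.2.1 then -1 else 1) * (if ε.2.2 then -1 else 1)

/-- The root vectors `X_{-ε}`, `ε ∈ Δ(V⁺)`, normalized by `⁅X_ε, X_{-ε}⁆ = H_ε`, equivalently by
`B(X_ε, X_{-ε}) = 1`. -/
def Xneg (ε : RootIdx) : g :=
  sign ε • adIf ε.1 (b.f 0) (adIf ε.2.1 (b.f 2) (adIf ε.2.2 (b.f 3) (b.f 1)))

/-- The root vector `X_{-γ}`, for which `X_γ = ⁅e 1, X_{γ - α₁}⁆` satisfies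
`⁅X_γ, X_{-γ}⁆ = H_γ`, equivalently `B(X_γ, X_{-γ}) = 1`. -/
def XnegGamma : g := ⁅b.f 1, ⁅b.f 0, ⁅b.f 2, ⁅b.f 3, b.f 1⁆⁆⁆⁆

/-- The alternating form on `V⁺` with `⁅U, W⁆ = ⟨U, W⟩ X_γ`. -/
def pairing (U W : g) : ℂ := B b ⁅U, W⁆ (XnegGamma b)

/-- The projection `Z ↦ Z - (dχ(Z) / dχ(H_γ)) H_γ` of `l = [l, l] ⊕ ℂ H_γ` onto `[l, l]`. -/
def derivedPart (Z : g) : g := Z - (B b Z (Hgamma b) / 2) • Hgamma b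

/-- `ω₂(Z) = -1/2 ∑_{α, β ∈ Δ(V⁺)} N_{β, γ-β} M_{α, γ-β}(Z) X_{-α} X_{-β}` for `Z ∈ [l, l]`, extended
to `l` by `ω₂(H_γ) = 0`. Here `⁅X_β, X_{γ-β}⁆ = N_{β, γ-β} X_γ` and
`⁅Z, X_α⁆ = ∑_δ M_{α, δ}(Z) X_δ`, hence `N_{β, γ-β} M_{α, γ-β}(Z) = ⟨X_β, ⁅Z, X_α⁆⟩`. -/
def omega2 (Z : g) : UniversalEnvelopingAlgebra ℂ g :=
  -(1 / 2 : ℂ) • ∑ α : RootIdx, ∑ β : RootIdx,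
    pairing b (X b β) ⁅derivedPart b Z, X b α⁆ •
      (UniversalEnvelopingAlgebra.ι ℂ (Xneg b α) * UniversalEnvelopingAlgebra.ι ℂ (Xneg b β))

/-- `ω₃(Y) = ∑_{ε ∈ Δ(V⁺)} X_{-ε} ω₂(⁅X_ε, Y⁆)` for `Y ∈ V⁻`. -/
def omega3 (Y : g) : UniversalEnvelopingAlgebra ℂ g :=
  ∑ ε : RootIdx, UniversalEnvelopingAlgebra.ι ℂ (Xneg b ε) * omega2 b ⁅X b ε, Y⁆

/-- The scalar generalized Verma module `M(ℂ_{-dχ}) = U(g) ⊗_{U(q)} ℂ_{-dχ}`. -/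
abbrev M (hA : b.A = CartanMatrix.D 4) : Type _ :=
  GenVerma (q b) (ScalarModule (-1) (dchi b hA))

/-- The span of the elements `ω₃(Y) ⊗ 1`, `Y ∈ V⁻ = g(-1)`, of `M(ℂ_{-dχ})`. -/
def omega3Span (hA : b.A = CartanMatrix.D 4) : Submodule ℂ (M b hA) :=
  Submodule.span ℂ {m | ∃ Y ∈ grade b (-1),
    m = GenVerma.mk (q b) (omega3 b Y) (ScalarModule.one (-1) (dchi b hA))}

end HeisenbergD4

end

open scoped TensorProduct

noncomputable section

/-! Write e_i, f_i, h_i for the Chevalley generators and w for ω₃(f₁) ⊗ 1. The canonical element ∑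
X_{-ε} ⊗ X_ε is invariant under the Levi factor l, and ω₂ and ω₃ are contractions with it, so ω₃ is
l-equivariant up to a multiple of dχ (`IsLevi.lie_omega2`, `IsLevi.lie_omega3`). Hence E is
l-stable. For n it is enough that e₁ kills the single vector w: V⁻ is obtained from f₁ by applying
f₀, f₂, f₃, which commute with e₁, and n is obtained from e₁ by brackets with the e_i. Since w is an
explicit cubic (`omega3_f_one`), this is a computation (`lie_e_one_omega3_f_one`); it succeeds
because h₁ acts on the generator of M by -1.

That w ≠ 0 (`omega3_f_one_smul_vac_ne_zero`) is shown without a PBW basis. The algebra g acts by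
derivations on S(g)[X_γ⁻¹], where X_γ⁻¹ transforms under q by -dχ. So u ⊗ 1 ↦ u · X_γ⁻¹ is well
defined on M, and evaluating the result at a suitable point of the dual of g separates w from 0.

The rest follows from w ≠ 0. For the sl₂ of α₀, w is a highest weight vector of weight 1, so w and
f₀ w are independent and dim E > 1. As q preserves E, the U(g)-span of E is its U(n̄)-span
(`lie_mem_nbarSpan`). There H_γ has only the eigenvalues -5, -6, ..., while the generator of M has
eigenvalue -2, so the span is proper. -/

namespace HeisenbergD4

attribute [local instance] LieRing.ofAssociativeRing

/-! ### Brackets of the Chevalley generators with the root vectors of V⁺ and X_γ -/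

section table

variable {g : Type*} [LieRing g] [LieAlgebra ℂ g] {H : LieSubalgebra ℂ g}
  {b : LieAlgebra.Basis (Fin 4) H}

/-- The root vector `X_γ = ⁅e 1, X_{γ - α₁}⁆`. -/
def Xgamma (b : LieAlgebra.Basis (Fin 4) H) : g := ⁅b.e 1, X b (true, true, true)⁆

/-- For the sl₂-triple with `e i` and `f i` exchanged, `e j` is primitive of weight `n`. In a
finite-dimensional module the lowering operator, here `e i`, kills it after `n + 1` steps. -/
lemma serre [FiniteDimensional ℂ g] {i j : Fin 4} (hij : j ≠ i) {n : ℕ} (hn : b.A j i = -n) :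
    ((LieModule.toEnd ℂ g g (b.e i)) ^ (n + 1)) (b.e j) = 0 := by
  have hp : (b.sl2 i).symm.HasPrimitiveVectorWith (b.e j) (n : ℂ) :=
    { ne_zero := (b.sl2 j).e_ne_zero
      lie_h := by rw [neg_lie, b.lie_h_e, hn]; simp [Nat.cast_smul_eq_nsmul]
      lie_e := by rw [← lie_skew, b.lie_e_f_ne j i hij, neg_zero] }
  exact hp.pow_toEnd_f_eq_zero_of_eq_nat rfl

lemma lie_e_e [FiniteDimensional ℂ g] (hA : b.A = CartanMatrix.D 4) {i j : Fin 4}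
    (hi : i ≠ 1) (hj : j ≠ 1) : ⁅b.e i, b.e j⁆ = 0 := by
  by_cases h : j = i
  · subst h; simp
  · have := serre (b := b) h (n := 0) (by
      rw [hA]; revert hi hj h; revert i j; decide)
    simpa using this

lemma lie_e_lie_e_e [FiniteDimensional ℂ g] (hA : b.A = CartanMatrix.D 4) {i : Fin 4}
    (hi : i ≠ 1) : ⁅b.e i, ⁅b.e i, b.e 1⁆⁆ = 0 := by
  have := serre (b := b) hi.symm (n := 1) (by
      rw [hA]; revert hi; revert i; decide)
  simpa [pow_succ] using this

lemma lie_e_one_lie_e_e [FiniteDimensional ℂ g] (hA : b.A = CartanMatrix.D 4) {i : Fin 4}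
    (hi : i ≠ 1) : ⁅b.e 1, ⁅b.e i, b.e 1⁆⁆ = 0 := by
  have := serre (b := b) hi (n := 1) (by
      rw [hA]; revert hi; revert i; decide)
  rw [← lie_skew (b.e i), lie_neg, neg_eq_zero]
  simpa [pow_succ, -lie_skew] using this

lemma lie_e_comm [FiniteDimensional ℂ g] (hA : b.A = CartanMatrix.D 4) {i j : Fin 4}
    (hi : i ≠ 1) (hj : j ≠ 1) (y : g) : ⁅b.e i, ⁅b.e j, y⁆⁆ = ⁅b.e j, ⁅b.e i, y⁆⁆ := by
  rw [leibniz_lie, lie_e_e hA hi hj, zero_lie, zero_add]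

lemma lie_f_e (i : Fin 4) : ⁅b.f i, b.e i⁆ = -b.h i := by
  rw [← lie_skew, (b.sl2 i).lie_e_f]

lemma lie_f_e_of_ne {i j : Fin 4} (h : i ≠ j) : ⁅b.f i, b.e j⁆ = 0 := by
  rw [← lie_skew, b.lie_e_f_ne _ _ h.symm, neg_zero]

lemma lie_f_lie_e (i : Fin 4) (y : g) :
    ⁅b.f i, ⁅b.e i, y⁆⁆ = ⁅b.e i, ⁅b.f i, y⁆⁆ - ⁅b.h i, y⁆ := by
  rw [leibniz_lie, lie_f_e, neg_lie]; abel

lemma lie_f_lie_e_of_ne {i j : Fin 4} (h : i ≠ j) (y : g) :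
    ⁅b.f i, ⁅b.e j, y⁆⁆ = ⁅b.e j, ⁅b.f i, y⁆⁆ := by
  rw [leibniz_lie, lie_f_e_of_ne h, zero_lie, zero_add]

lemma lie_h_lie_e (i j : Fin 4) (y : g) :
    ⁅b.h i, ⁅b.e j, y⁆⁆ = ⁅b.e j, ⁅b.h i, y⁆⁆ + b.A j i • ⁅b.e j, y⁆ := by
  rw [leibniz_lie, b.lie_h_e, zsmul_lie, add_comm]

lemma lie_h_zero_X (hA : b.A = CartanMatrix.D 4) (p q r : Bool) :
    ⁅b.h 0, X b (p, q, r)⁆ = (if p then 1 else -1 : ℂ) • X b (p, q, r) := by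
  cases p <;> cases q <;> cases r <;>
    simp [X, adIf, lie_h_lie_e, b.lie_h_e, hA, CartanMatrix.D, -lie_skew] <;> module

lemma lie_h_two_X (hA : b.A = CartanMatrix.D 4) (p q r : Bool) :
    ⁅b.h 2, X b (p, q, r)⁆ = (if q then 1 else -1 : ℂ) • X b (p, q, r) := by
  cases p <;> cases q <;> cases r <;>
    simp [X, adIf, lie_h_lie_e, b.lie_h_e, hA, CartanMatrix.D, -lie_skew] <;> module

lemma lie_h_three_X (hA : b.A = CartanMatrix.D 4) (p q r : Bool) :
    ⁅b.h 3, X b (p, q, r)⁆ = (if r then 1 else -1 : ℂ) • X b (p, q, r) := by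
  cases p <;> cases q <;> cases r <;>
    simp [X, adIf, lie_h_lie_e, b.lie_h_e, hA, CartanMatrix.D, -lie_skew] <;> module

lemma lie_h_one_X (hA : b.A = CartanMatrix.D 4) (p q r : Bool) :
    ⁅b.h 1, X b (p, q, r)⁆ = (2 - (if p then 1 else 0) - (if q then 1 else 0) -
      (if r then 1 else 0) : ℂ) • X b (p, q, r) := by
  cases p <;> cases q <;> cases r <;>
    simp [X, adIf, lie_h_lie_e, b.lie_h_e, hA, CartanMatrix.D, -lie_skew] <;> module

lemma lie_f_zero_X (hA : b.A = CartanMatrix.D 4) (p q r : Bool) :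
    ⁅b.f 0, X b (p, q, r)⁆ = if p then X b (false, q, r) else 0 := by
  have hf (q r : Bool) : ⁅b.f 0, X b (false, q, r)⁆ = 0 := by
    cases q <;> cases r <;> simp [X, adIf, lie_f_lie_e_of_ne, lie_f_e_of_ne]
  cases p
  · simp [hf]
  · have : X b (true, q, r) = ⁅b.e 0, X b (false, q, r)⁆ := by simp [X, adIf]
    rw [this, lie_f_lie_e, hf, lie_h_zero_X hA]
    simp

lemma lie_f_two_X (hA : b.A = CartanMatrix.D 4) (p q r : Bool) :
    ⁅b.f 2, X b (p, q, r)⁆ = if q then X b (p, false, r) else 0 := by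
  have hf (r : Bool) : ⁅b.f 2, X b (false, false, r)⁆ = 0 := by
    cases r <;> simp [X, adIf, lie_f_lie_e_of_ne, lie_f_e_of_ne]
  have hp (q : Bool) : X b (true, q, r) = ⁅b.e 0, X b (false, q, r)⁆ := by simp [X, adIf]
  have hq : ⁅b.f 2, X b (false, q, r)⁆ = if q then X b (false, false, r) else 0 := by
    cases q
    · simp [hf]
    · have : X b (false, true, r) = ⁅b.e 2, X b (false, false, r)⁆ := by simp [X, adIf]
      rw [this, lie_f_lie_e, hf, lie_h_two_X hA]
      simp
  cases p
  · exact hq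
  · rw [hp, hp, lie_f_lie_e_of_ne (by decide), hq]
    split_ifs <;> simp

lemma lie_f_three_X (hA : b.A = CartanMatrix.D 4) (p q r : Bool) :
    ⁅b.f 3, X b (p, q, r)⁆ = if r then X b (p, q, false) else 0 := by
  have hr : ⁅b.f 3, X b (false, false, r)⁆ = if r then X b (false, false, false) else 0 := by
    cases r
    · simp [X, adIf, lie_f_e_of_ne]
    · have h1 : X b (false, false, true) = ⁅b.e 3, X b (false, false, false)⁆ := by simp [X, adIf]
      have h2 : ⁅b.f 3, X b (false, false, false)⁆ = 0 := by
        simp [X, adIf, lie_f_e_of_ne]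
      rw [h1, lie_f_lie_e, h2, lie_h_three_X hA]
      simp
  have hX (r : Bool) : X b (p, q, r) =
      adIf p (b.e 0) (adIf q (b.e 2) (X b (false, false, r))) := by simp [X, adIf]
  rw [hX, hX]
  cases p <;> cases q <;> simp [adIf, lie_f_lie_e_of_ne, hr] <;> split_ifs <;> simp

/-- Applying `ad a` twice to `⁅x, z⁆ = 0` leaves only the cross term `2 ⁅⁅a, x⁆, w⁆`. It is used
with `a` an outer simple root vector, `x = b.e 1`, `w` the root vector of γ - α₁, and `z` the one
with the outer root removed. -/
lemma lie_e_Xgamma_aux {a x z w : g} (h1 : ⁅x, z⁆ = 0) (h2 : ⁅a, ⁅a, x⁆⁆ = 0) (h3 : ⁅a, z⁆ = w)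
    (h4 : ⁅a, w⁆ = 0) : ⁅a, ⁅x, w⁆⁆ = 0 := by
  have e1 := congrArg (fun y ↦ ⁅a, ⁅a, y⁆⁆) h1
  simp only [leibniz_lie a x, h3, lie_add, lie_zero, leibniz_lie a ⁅a, x⁆, h2, zero_lie, h4,
    zero_add, add_zero] at e1
  rw [leibniz_lie, h4, lie_zero, add_zero]
  have : (2 : ℂ) • ⁅⁅a, x⁆, w⁆ = 0 := by rw [two_smul, e1]
  simpa using this

lemma lie_h_Xgamma (hA : b.A = CartanMatrix.D 4) (i : Fin 4) :
    ⁅b.h i, Xgamma b⁆ = (if i = 1 then 1 else 0 : ℂ) • Xgamma b := by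
  rw [Xgamma, lie_h_lie_e]
  fin_cases i <;> simp [lie_h_zero_X hA, lie_h_one_X hA, lie_h_two_X hA, lie_h_three_X hA, hA,
    CartanMatrix.D, -lie_skew] <;> module

variable [FiniteDimensional ℂ g]

lemma lie_e_zero_X (hA : b.A = CartanMatrix.D 4) (p q r : Bool) :
    ⁅b.e 0, X b (p, q, r)⁆ = if p then 0 else X b (true, q, r) := by
  have h0 := lie_e_lie_e_e hA (b := b) (i := 0) (by decide)
  have h2 := lie_e_comm hA (b := b) (i := 0) (j := 2) (by decide) (by decide)
  have h3 := lie_e_comm hA (b := b) (i := 0) (j := 3) (by decide) (by decide)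
  cases p <;> cases q <;> cases r <;> simp [X, adIf, h0, h2, h3]

lemma lie_e_two_X (hA : b.A = CartanMatrix.D 4) (p q r : Bool) :
    ⁅b.e 2, X b (p, q, r)⁆ = if q then 0 else X b (p, true, r) := by
  have h0 := lie_e_lie_e_e hA (b := b) (i := 2) (by decide)
  have h2 := lie_e_comm hA (b := b) (i := 2) (j := 0) (by decide) (by decide)
  have h3 := lie_e_comm hA (b := b) (i := 2) (j := 3) (by decide) (by decide)
  cases p <;> cases q <;> cases r <;> simp [X, adIf, h0, h2, h3]

lemma lie_e_three_X (hA : b.A = CartanMatrix.D 4) (p q r : Bool) :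
    ⁅b.e 3, X b (p, q, r)⁆ = if r then 0 else X b (p, q, true) := by
  have h0 := lie_e_lie_e_e hA (b := b) (i := 3) (by decide)
  have h2 := lie_e_comm hA (b := b) (i := 3) (j := 0) (by decide) (by decide)
  have h3 := lie_e_comm hA (b := b) (i := 3) (j := 2) (by decide) (by decide)
  cases p <;> cases q <;> cases r <;> simp [X, adIf, h0, h2, h3]

lemma lie_f_one_X (hA : b.A = CartanMatrix.D 4) (ε : RootIdx) :
    ⁅b.f 1, X b ε⁆ = match ε with
      | (false, false, false) => -b.h 1
      | (true, false, false) => -b.e 0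
      | (false, true, false) => -b.e 2
      | (false, false, true) => -b.e 3
      | _ => 0 := by
  have hh (i : Fin 4) : ⁅b.e i, b.h 1⁆ = -(b.A i 1 • b.e i) := by
    rw [← lie_skew, b.lie_h_e]
  have h02 := lie_e_e hA (b := b) (i := 0) (j := 2) (by decide) (by decide)
  have h03 := lie_e_e hA (b := b) (i := 0) (j := 3) (by decide) (by decide)
  have h23 := lie_e_e hA (b := b) (i := 2) (j := 3) (by decide) (by decide)
  obtain ⟨p, q, r⟩ := ε
  cases p <;> cases q <;> cases r <;>
    simp [X, adIf, lie_f_lie_e_of_ne, lie_f_e, hh, hA, CartanMatrix.D, h02, h03, h23, -lie_skew]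

lemma lie_e_one_X (hA : b.A = CartanMatrix.D 4) (p q r : Bool) :
    ⁅b.e 1, X b (p, q, r)⁆ = if p && q && r then Xgamma b else 0 := by
  have h0 := lie_e_one_lie_e_e hA (b := b) (i := 0) (by decide)
  have h2 := lie_e_one_lie_e_e hA (b := b) (i := 2) (by decide)
  have h3 := lie_e_one_lie_e_e hA (b := b) (i := 3) (by decide)
  -- Apply `e i` to one Serre relation and `e j` to the other. The terms `⁅⁅e i, e 1⁆, ⁅e j, e 1⁆⁆`
  -- and `⁅⁅e j, e 1⁆, ⁅e i, e 1⁆⁆` cancel in the sum, which leaves twice the wanted bracket.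
  have key {i j : Fin 4} (hi : i ≠ 1) (hj : j ≠ 1) : ⁅b.e 1, ⁅b.e i, ⁅b.e j, b.e 1⁆⁆⁆ = 0 := by
    have e1 := congrArg (fun y ↦ ⁅b.e i, y⁆) (lie_e_one_lie_e_e hA (b := b) hj)
    have e2 := congrArg (fun y ↦ ⁅b.e j, y⁆) (lie_e_one_lie_e_e hA (b := b) hi)
    simp only [lie_zero, leibniz_lie (b.e i) (b.e 1), leibniz_lie (b.e j) (b.e 1)] at e1 e2
    rw [lie_e_comm hA hj hi, ← lie_skew] at e2
    have e3 : (2 : ℂ) • ⁅b.e 1, ⁅b.e i, ⁅b.e j, b.e 1⁆⁆⁆ = 0 := by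
      rw [two_smul]
      nth_rw 1 [eq_neg_of_add_eq_zero_right e1, eq_neg_of_add_eq_zero_right e2]
      rw [neg_neg, neg_add_cancel]
    simpa using e3
  cases p <;> cases q <;> cases r <;>
    simp [X, adIf, h0, h2, h3, key, Xgamma]

lemma lie_e_Xgamma (hA : b.A = CartanMatrix.D 4) (i : Fin 4) : ⁅b.e i, Xgamma b⁆ = 0 := by
  have e1 := lie_e_one_X hA (b := b)
  fin_cases i
  · exact lie_e_Xgamma_aux (z := X b (false, true, true)) (by simp [e1])
      (lie_e_lie_e_e hA (by decide)) (by simp [lie_e_zero_X hA]) (by simp [lie_e_zero_X hA])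
  -- This writes X_γ as a bracket of two vectors that `e 1` kills.
  · have : Xgamma b = -⁅⁅b.e 0, b.e 1⁆, X b (false, true, true)⁆ := by
      have h : ⁅b.e 0, ⁅b.e 1, X b (false, true, true)⁆⁆ = 0 := by simp [e1]
      rw [leibniz_lie, lie_e_zero_X hA] at h
      exact eq_neg_of_add_eq_zero_right h
    change ⁅b.e 1, Xgamma b⁆ = 0
    rw [this, lie_neg, leibniz_lie, e1, lie_e_one_lie_e_e hA (by decide)]
    simp
  · exact lie_e_Xgamma_aux (z := X b (true, false, true)) (by simp [e1])
      (lie_e_lie_e_e hA (by decide)) (by simp [lie_e_two_X hA]) (by simp [lie_e_two_X hA])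
  · exact lie_e_Xgamma_aux (z := X b (true, true, false)) (by simp [e1])
      (lie_e_lie_e_e hA (by decide)) (by simp [lie_e_three_X hA]) (by simp [lie_e_three_X hA])

/-- The Leibniz rule moves the outer simple roots of the first factor one at a time to the second,
each at the cost of a sign, until the first factor is `b.e 1`. The outer derivative never
contributes to a multiple of X_γ, which every `e i` kills. -/
lemma lie_X_X (hA : b.A = CartanMatrix.D 4) (p q r p' q' r' : Bool) :
    ⁅X b (p, q, r), X b (p', q', r')⁆ =
      if p' = !p ∧ q' = !q ∧ r' = !r then sign (p, q, r) • Xgamma b else 0 := by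
  have t0 (q r p' q' r' : Bool) : ⁅X b (true, q, r), X b (p', q', r')⁆ =
      ⁅b.e 0, ⁅X b (false, q, r), X b (p', q', r')⁆⁆ -
        if p' then 0 else ⁅X b (false, q, r), X b (true, q', r')⁆ := by
    rw [leibniz_lie, lie_e_zero_X hA, lie_e_zero_X hA]
    cases p' <;> simp
  have t2 (p r p' q' r' : Bool) : ⁅X b (p, true, r), X b (p', q', r')⁆ =
      ⁅b.e 2, ⁅X b (p, false, r), X b (p', q', r')⁆⁆ -
        if q' then 0 else ⁅X b (p, false, r), X b (p', true, r')⁆ := by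
    rw [leibniz_lie, lie_e_two_X hA, lie_e_two_X hA]
    cases q' <;> simp
  have t3 (p q p' q' r' : Bool) : ⁅X b (p, q, true), X b (p', q', r')⁆ =
      ⁅b.e 3, ⁅X b (p, q, false), X b (p', q', r')⁆⁆ -
        if r' then 0 else ⁅X b (p, q, false), X b (p', q', true)⁆ := by
    rw [leibniz_lie, lie_e_three_X hA, lie_e_three_X hA]
    cases r' <;> simp
  have t1 (p' q' r' : Bool) : ⁅X b (false, false, false), X b (p', q', r')⁆ =
      if p' && q' && r' then Xgamma b else 0 := by
    rw [← lie_e_one_X hA]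
    simp [X, adIf]
  have key (r p' q' r' : Bool) : ⁅X b (false, false, r), X b (p', q', r')⁆ =
      if p' = true ∧ q' = true ∧ r' = !r then sign (false, false, r) • Xgamma b else 0 := by
    cases r
    · rw [t1]; simp [sign, and_assoc]
    · rw [t3, t1, t1]
      cases p' <;> cases q' <;> cases r' <;> simp [sign, lie_e_Xgamma hA]
  have key2 (q r p' q' r' : Bool) : ⁅X b (false, q, r), X b (p', q', r')⁆ =
      if p' = true ∧ q' = !q ∧ r' = !r then sign (false, q, r) • Xgamma b else 0 := by
    cases q
    · rw [key]; simp
    · rw [t2, key, key]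
      cases p' <;> cases q' <;> cases r <;> cases r' <;> simp [sign, lie_e_Xgamma hA]
  cases p
  · rw [key2]; simp
  · rw [t0, key2, key2]
    cases p' <;> cases q <;> cases q' <;> cases r <;> cases r' <;> simp [sign, lie_e_Xgamma hA]

lemma lie_f_Xgamma (hA : b.A = CartanMatrix.D 4) (i : Fin 4) :
    ⁅b.f i, Xgamma b⁆ = if i = 1 then X b (true, true, true) else 0 := by
  have e1 := lie_e_one_X hA (b := b)
  rw [Xgamma]
  by_cases hi : i = 1
  · subst hi
    rw [lie_f_lie_e, lie_f_one_X hA, lie_h_one_X hA]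
    simp
    module
  · rw [lie_f_lie_e_of_ne hi, if_neg hi]
    fin_cases i
    · simp [lie_f_zero_X hA, e1]
    · simp at hi
    · simp [lie_f_two_X hA, e1]
    · simp [lie_f_three_X hA, e1]

end table

/-! ### Negative root vectors and spanning sets of the graded pieces -/

section span

variable {g : Type*} [LieRing g] [LieAlgebra ℂ g] {H : LieSubalgebra ℂ g}
  {b : LieAlgebra.Basis (Fin 4) H}

lemma Hgamma_symm : Hgamma b.symm = -Hgamma b := by
  simp only [Hgamma, LieAlgebra.Basis.symm_h, Pi.neg_apply]
  module

lemma Xgamma_symm : Xgamma b.symm = XnegGamma b := by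
  simp [Xgamma, XnegGamma, X, adIf]

/-- `b.symm` exchanges `e` with `f` and negates `h`, so every table for V⁺ yields one for V⁻ when
applied to `b.symm`. -/
lemma Xneg_eq (ε : RootIdx) : Xneg b ε = sign ε • X b.symm ε := by
  simp [Xneg, X]

lemma lie_e_zero_X_symm (hA : b.A = CartanMatrix.D 4) (p q r : Bool) :
    ⁅b.e 0, X b.symm (p, q, r)⁆ = if p then X b.symm (false, q, r) else 0 :=
  lie_f_zero_X (b := b.symm) hA p q r

lemma lie_e_two_X_symm (hA : b.A = CartanMatrix.D 4) (p q r : Bool) :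
    ⁅b.e 2, X b.symm (p, q, r)⁆ = if q then X b.symm (p, false, r) else 0 :=
  lie_f_two_X (b := b.symm) hA p q r

lemma lie_e_three_X_symm (hA : b.A = CartanMatrix.D 4) (p q r : Bool) :
    ⁅b.e 3, X b.symm (p, q, r)⁆ = if r then X b.symm (p, q, false) else 0 :=
  lie_f_three_X (b := b.symm) hA p q r

lemma lie_h_zero_X_symm (hA : b.A = CartanMatrix.D 4) (p q r : Bool) :
    ⁅b.h 0, X b.symm (p, q, r)⁆ = (if p then -1 else 1 : ℂ) • X b.symm (p, q, r) := by
  have := lie_h_zero_X (b := b.symm) hA p q r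
  rw [LieAlgebra.Basis.symm_h, Pi.neg_apply, neg_lie, neg_eq_iff_eq_neg] at this
  rw [this]
  split_ifs <;> module

lemma lie_h_one_X_symm (hA : b.A = CartanMatrix.D 4) (p q r : Bool) :
    ⁅b.h 1, X b.symm (p, q, r)⁆ = (-2 + (if p then 1 else 0) + (if q then 1 else 0) +
      (if r then 1 else 0) : ℂ) • X b.symm (p, q, r) := by
  have := lie_h_one_X (b := b.symm) hA p q r
  rw [LieAlgebra.Basis.symm_h, Pi.neg_apply, neg_lie, neg_eq_iff_eq_neg] at this
  rw [this]
  module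

lemma lie_h_two_X_symm (hA : b.A = CartanMatrix.D 4) (p q r : Bool) :
    ⁅b.h 2, X b.symm (p, q, r)⁆ = (if q then -1 else 1 : ℂ) • X b.symm (p, q, r) := by
  have := lie_h_two_X (b := b.symm) hA p q r
  rw [LieAlgebra.Basis.symm_h, Pi.neg_apply, neg_lie, neg_eq_iff_eq_neg] at this
  rw [this]
  split_ifs <;> module

lemma lie_h_three_X_symm (hA : b.A = CartanMatrix.D 4) (p q r : Bool) :
    ⁅b.h 3, X b.symm (p, q, r)⁆ = (if r then -1 else 1 : ℂ) • X b.symm (p, q, r) := by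
  have := lie_h_three_X (b := b.symm) hA p q r
  rw [LieAlgebra.Basis.symm_h, Pi.neg_apply, neg_lie, neg_eq_iff_eq_neg] at this
  rw [this]
  split_ifs <;> module

lemma lie_h_XnegGamma (hA : b.A = CartanMatrix.D 4) (i : Fin 4) :
    ⁅b.h i, XnegGamma b⁆ = (if i = 1 then -1 else 0 : ℂ) • XnegGamma b := by
  have := lie_h_Xgamma (b := b.symm) hA i
  rw [LieAlgebra.Basis.symm_h, Pi.neg_apply, neg_lie, neg_eq_iff_eq_neg, Xgamma_symm] at this
  rw [this]
  split_ifs <;> module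

/-- Spanning vectors of the eigenspace `g(k)` of `ad H_γ`. -/
def gradeGen (b : LieAlgebra.Basis (Fin 4) H) (k : ℤ) : Set g :=
  if k = 2 then {Xgamma b} else if k = 1 then Set.range (X b) else
  if k = 0 then Set.range b.h ∪ b.e '' {1}ᶜ ∪ b.f '' {1}ᶜ else
  if k = -1 then Set.range (X b.symm) else if k = -2 then {XnegGamma b} else ∅

lemma span_gradeGen_symm :
    Submodule.span ℂ (⋃ k, gradeGen b.symm k) = Submodule.span ℂ (⋃ k, gradeGen b k) := by
  have key (b : LieAlgebra.Basis (Fin 4) H) : Submodule.span ℂ (⋃ k, gradeGen b.symm k) ≤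
      Submodule.span ℂ (⋃ k, gradeGen b k) := by
    refine Submodule.span_le.mpr (Set.iUnion_subset fun k x hx ↦ ?_)
    have hmem {y : g} (k : ℤ) (hy : y ∈ gradeGen b k) :
      y ∈ Submodule.span ℂ (⋃ k, gradeGen b k) := Submodule.subset_span (Set.mem_iUnion_of_mem k hy)
    rw [gradeGen] at hx
    split_ifs at hx with h1 h2 h3 h4 h5
    · exact hmem (-2) (by simpa [gradeGen, Xgamma_symm] using hx)
    · exact hmem (-1) (by simpa [gradeGen] using hx)
    · rcases hx with (⟨i, rfl⟩ | ⟨i, hi, rfl⟩) | ⟨i, hi, rfl⟩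
      · exact neg_mem (hmem 0 (by simp [gradeGen]))
      · exact hmem 0 (Or.inr ⟨i, hi, rfl⟩)
      · exact hmem 0 (Or.inl (Or.inr ⟨i, hi, rfl⟩))
    · exact hmem 1 (by simpa [gradeGen] using hx)
    · exact hmem 2 (by simpa [gradeGen, ← Xgamma_symm] using hx)
    · exact hx.elim
  exact le_antisymm (key b) (by simpa using key b.symm)

lemma X_mem_grade (hA : b.A = CartanMatrix.D 4) (ε : RootIdx) : X b ε ∈ grade b 1 := by
  obtain ⟨p, q, r⟩ := ε
  simp only [grade, Module.End.mem_eigenspace_iff, LieAlgebra.ad_apply, Hgamma, add_lie, smul_lie,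
    lie_h_zero_X hA, lie_h_one_X hA, lie_h_two_X hA, lie_h_three_X hA, smul_smul, ← add_smul]
  congr 1
  cases p <;> cases q <;> cases r <;> norm_num

lemma Xgamma_mem_grade (hA : b.A = CartanMatrix.D 4) : Xgamma b ∈ grade b 2 := by
  simp only [grade, Module.End.mem_eigenspace_iff, LieAlgebra.ad_apply, Hgamma, add_lie, smul_lie,
    lie_h_Xgamma hA]
  simp

lemma mem_grade_symm {k : ℤ} {x : g} : x ∈ grade b.symm k ↔ x ∈ grade b (-k) := by
  simp only [grade, Module.End.mem_eigenspace_iff, LieAlgebra.ad_apply, Hgamma_symm, neg_lie]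
  push_cast
  rw [neg_smul, neg_eq_iff_eq_neg]

lemma X_symm_mem_grade (hA : b.A = CartanMatrix.D 4) (ε : RootIdx) :
    X b.symm ε ∈ grade b (-1) :=
  mem_grade_symm.mp (X_mem_grade (b := b.symm) hA ε)

lemma XnegGamma_mem_grade (hA : b.A = CartanMatrix.D 4) : XnegGamma b ∈ grade b (-2) := by
  rw [← Xgamma_symm]
  exact mem_grade_symm.mp (Xgamma_mem_grade (b := b.symm) hA)

variable [FiniteDimensional ℂ g]

lemma lie_e_one_X_symm (hA : b.A = CartanMatrix.D 4) (ε : RootIdx) :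
    ⁅b.e 1, X b.symm ε⁆ = match ε with
      | (false, false, false) => b.h 1
      | (true, false, false) => -b.f 0
      | (false, true, false) => -b.f 2
      | (false, false, true) => -b.f 3
      | _ => 0 := by
  rw [show b.e 1 = b.symm.f 1 from rfl, lie_f_one_X (b := b.symm) hA]
  obtain ⟨p, q, r⟩ := ε
  cases p <;> cases q <;> cases r <;> simp

lemma lie_f_zero_X_symm (hA : b.A = CartanMatrix.D 4) (p q r : Bool) :
    ⁅b.f 0, X b.symm (p, q, r)⁆ = if p then 0 else X b.symm (true, q, r) :=
  lie_e_zero_X (b := b.symm) hA p q r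

lemma lie_f_two_X_symm (hA : b.A = CartanMatrix.D 4) (p q r : Bool) :
    ⁅b.f 2, X b.symm (p, q, r)⁆ = if q then 0 else X b.symm (p, true, r) :=
  lie_e_two_X (b := b.symm) hA p q r

lemma lie_f_three_X_symm (hA : b.A = CartanMatrix.D 4) (p q r : Bool) :
    ⁅b.f 3, X b.symm (p, q, r)⁆ = if r then 0 else X b.symm (p, q, true) :=
  lie_e_three_X (b := b.symm) hA p q r

lemma lie_X_X_symm (hA : b.A = CartanMatrix.D 4) (p q r p' q' r' : Bool) :
    ⁅X b.symm (p, q, r), X b.symm (p', q', r')⁆ =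
      if p' = !p ∧ q' = !q ∧ r' = !r then sign (p, q, r) • XnegGamma b else 0 := by
  rw [lie_X_X (b := b.symm) hA, Xgamma_symm]

lemma lie_e_XnegGamma (hA : b.A = CartanMatrix.D 4) (i : Fin 4) :
    ⁅b.e i, XnegGamma b⁆ = if i = 1 then X b.symm (true, true, true) else 0 := by
  rw [← Xgamma_symm]
  exact lie_f_Xgamma (b := b.symm) hA i

lemma lie_f_XnegGamma (hA : b.A = CartanMatrix.D 4) (i : Fin 4) : ⁅b.f i, XnegGamma b⁆ = 0 := by
  rw [← Xgamma_symm]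
  exact lie_e_Xgamma (b := b.symm) hA i

lemma lie_e_mem_span_gradeGen (hA : b.A = CartanMatrix.D 4) (j : Fin 4) {x : g}
    (hx : x ∈ Submodule.span ℂ (⋃ k, gradeGen b k)) :
    ⁅b.e j, x⁆ ∈ Submodule.span ℂ (⋃ k, gradeGen b k) := by
  have hmem {y : g} (k : ℤ) (hy : y ∈ gradeGen b k) :
    y ∈ Submodule.span ℂ (⋃ k, gradeGen b k) := Submodule.subset_span (Set.mem_iUnion_of_mem k hy)
  have hX (ε) : X b ε ∈ Submodule.span ℂ (⋃ k, gradeGen b k) := hmem 1 (by simp [gradeGen])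
  have hF (ε) : X b.symm ε ∈ Submodule.span ℂ (⋃ k, gradeGen b k) :=
    hmem (-1) (by simp [gradeGen])
  have hh (i) : b.h i ∈ Submodule.span ℂ (⋃ k, gradeGen b k) := hmem 0 (by simp [gradeGen])
  have he (i) : b.e i ∈ Submodule.span ℂ (⋃ k, gradeGen b k) := by
    by_cases hi : i = 1
    · subst hi; exact hX (false, false, false)
    · exact hmem 0 (Or.inl (Or.inr ⟨i, hi, rfl⟩))
  have hf {i} (hi : i ≠ 1) : b.f i ∈ Submodule.span ℂ (⋃ k, gradeGen b k) :=
    hmem 0 (Or.inr ⟨i, hi, rfl⟩)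
  have hG : Xgamma b ∈ Submodule.span ℂ (⋃ k, gradeGen b k) := hmem 2 (by simp [gradeGen])
  induction hx using Submodule.span_induction with
  | zero => simp
  | add x y _ _ h h' => rw [lie_add]; exact add_mem h h'
  | smul t x _ h => rw [lie_smul]; exact Submodule.smul_mem _ t h
  | mem x hx =>
    obtain ⟨k, hx⟩ := Set.mem_iUnion.mp hx
    rw [gradeGen] at hx
    split_ifs at hx with h1 h2 h3 h4 h5
    · rw [Set.mem_singleton_iff.mp hx, lie_e_Xgamma hA]
      exact zero_mem _
    · obtain ⟨⟨p, q, r⟩, rfl⟩ := hx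
      fin_cases j
      · change ⁅b.e 0, _⁆ ∈ _; rw [lie_e_zero_X hA]; split_ifs; exacts [zero_mem _, hX _]
      · change ⁅b.e 1, _⁆ ∈ _; rw [lie_e_one_X hA]; split_ifs; exacts [hG, zero_mem _]
      · change ⁅b.e 2, _⁆ ∈ _; rw [lie_e_two_X hA]; split_ifs; exacts [zero_mem _, hX _]
      · change ⁅b.e 3, _⁆ ∈ _; rw [lie_e_three_X hA]; split_ifs; exacts [zero_mem _, hX _]
    · rcases hx with (⟨i, rfl⟩ | ⟨i, hi, rfl⟩) | ⟨i, hi, rfl⟩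
      · rw [← lie_skew, b.lie_h_e]
        exact neg_mem (zsmul_mem (he j) _)
      · by_cases hj : j = 1
        · subst hj
          rw [← lie_skew]
          refine neg_mem ?_
          fin_cases i
          · exact hX (true, false, false)
          · exact (hi rfl).elim
          · exact hX (false, true, false)
          · exact hX (false, false, true)
        · rw [lie_e_e hA hj hi]
          exact zero_mem _
      · by_cases hj : j = i
        · subst hj
          rw [(b.sl2 j).lie_e_f]
          exact hh j
        · rw [b.lie_e_f_ne _ _ hj]
          exact zero_mem _
    · obtain ⟨⟨p, q, r⟩, rfl⟩ := hx
      fin_cases j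
      · change ⁅b.e 0, _⁆ ∈ _
        rw [lie_e_zero_X_symm hA]; split_ifs; exacts [hF _, zero_mem _]
      · change ⁅b.e 1, _⁆ ∈ _
        rw [lie_e_one_X_symm hA]
        split
        · exact hh 1
        · exact neg_mem (hf (by decide))
        · exact neg_mem (hf (by decide))
        · exact neg_mem (hf (by decide))
        · exact zero_mem _
      · change ⁅b.e 2, _⁆ ∈ _
        rw [lie_e_two_X_symm hA]; split_ifs; exacts [hF _, zero_mem _]
      · change ⁅b.e 3, _⁆ ∈ _
        rw [lie_e_three_X_symm hA]; split_ifs; exacts [hF _, zero_mem _]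
    · rw [Set.mem_singleton_iff.mp hx, lie_e_XnegGamma hA]
      split_ifs
      exacts [hF _, zero_mem _]
    · exact hx.elim

/-- The span contains the Chevalley generators and is stable under bracketing with them; the `f`
half follows from the `e` half through `b.symm`. These generators generate `g`. -/
lemma span_gradeGen (hA : b.A = CartanMatrix.D 4) :
    Submodule.span ℂ (⋃ k, gradeGen b k) = ⊤ := by
  set S := Submodule.span ℂ (⋃ k, gradeGen b k) with hS
  have key {y : g} (hy : y ∈ LieSubalgebra.lieSpan ℂ g (Set.range b.e ∪ Set.range b.f)) :
      ∀ x ∈ S, ⁅y, x⁆ ∈ S := by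
    induction hy using LieSubalgebra.lieSpan_induction with
    | mem u hu =>
      rcases hu with ⟨i, rfl⟩ | ⟨i, rfl⟩
      · exact fun x hx ↦ lie_e_mem_span_gradeGen hA i hx
      · intro x hx
        rw [hS, ← span_gradeGen_symm] at hx ⊢
        exact lie_e_mem_span_gradeGen (b := b.symm) hA i hx
    | zero => simp
    | add u v _ _ hu hv => intro x hx; rw [add_lie]; exact add_mem (hu x hx) (hv x hx)
    | smul t u _ hu => intro x hx; rw [smul_lie]; exact Submodule.smul_mem _ t (hu x hx)
    | lie u v _ _ hu hv =>
      intro x hx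
      rw [lie_lie]
      exact sub_mem (hu _ (hv x hx)) (hv _ (hu x hx))
  rw [b.span_ef] at key
  have he (b : LieAlgebra.Basis (Fin 4) H) (i) :
      b.e i ∈ Submodule.span ℂ (⋃ k, gradeGen b k) := by
    refine Submodule.subset_span ?_
    by_cases hi : i = 1
    · subst hi; exact Set.mem_iUnion_of_mem 1 ⟨(false, false, false), rfl⟩
    · exact Set.mem_iUnion_of_mem 0 (Or.inl (Or.inr ⟨i, hi, rfl⟩))
  refine eq_top_iff.mpr fun x _ ↦ ?_
  have hx : x ∈ LieSubalgebra.lieSpan ℂ g (Set.range b.e ∪ Set.range b.f) := by simp [b.span_ef]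
  induction hx using LieSubalgebra.lieSpan_induction with
  | mem u hu =>
    rcases hu with ⟨i, rfl⟩ | ⟨i, rfl⟩
    · exact he b i
    · rw [hS, ← span_gradeGen_symm]
      exact he b.symm i
  | zero => simp
  | add u v _ _ hu hv => exact add_mem (hu trivial) (hv trivial)
  | smul t u _ hu => exact Submodule.smul_mem _ t (hu trivial)
  | lie u v _ _ hu hv => exact key (by simp) _ (hv trivial)

/-- Each listed set lies in its eigenspace, the sets together span `g`, and eigenspaces are
independent, so no inclusion can be strict. -/
lemma span_gradeGen_eq (hA : b.A = CartanMatrix.D 4) (k : ℤ) :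
    Submodule.span ℂ (gradeGen b k) = grade b k := by
  have hind : iSupIndep (grade b) :=
    (Module.End.eigenspaces_iSupIndep (LieAlgebra.ad ℂ g (Hgamma b))).comp Int.cast_injective
  have htop : ⨆ k, Submodule.span ℂ (gradeGen b k) = ⊤ := by
    rw [← Submodule.span_iUnion, span_gradeGen hA]
  refine congrFun ((hind.le_iff_eq_of_iSup_eq_top htop).mp fun k ↦ ?_) k
  refine Submodule.span_le.mpr fun x hx ↦ ?_
  rw [gradeGen] at hx
  split_ifs at hx with h1 h2 h3 h4 h5
  · subst h1; rw [Set.mem_singleton_iff.mp hx]; exact Xgamma_mem_grade hA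
  · subst h2; obtain ⟨ε, rfl⟩ := hx; exact X_mem_grade hA ε
  · subst h3
    simp only [grade, SetLike.mem_coe, Module.End.mem_eigenspace_iff, LieAlgebra.ad_apply]
    rcases hx with (⟨i, rfl⟩ | ⟨i, hi, rfl⟩) | ⟨i, hi, rfl⟩
    · simp [Hgamma, b.lie_h_h]
    · rw [lie_e hA, if_neg (by simpa using hi)]; simp
    · rw [lie_f hA, if_neg (by simpa using hi)]; simp
  · subst h4; obtain ⟨ε, rfl⟩ := hx
    exact X_symm_mem_grade hA ε
  · subst h5; rw [Set.mem_singleton_iff.mp hx]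
    exact XnegGamma_mem_grade hA
  · exact hx.elim

end span

/-! ### The invariant form on root vectors and its normalization -/

section form

variable {g : Type*} [LieRing g] [LieAlgebra ℂ g] {H : LieSubalgebra ℂ g}
  {b : LieAlgebra.Basis (Fin 4) H}

lemma killingForm_lie_left (x y z : g) : killingForm ℂ g ⁅x, y⁆ z = killingForm ℂ g x ⁅y, z⁆ := by
  simp [killingForm, LieModule.traceForm_apply_lie_apply]

lemma killingForm_lie_right (x y z : g) : killingForm ℂ g x ⁅y, z⁆ = -killingForm ℂ g ⁅y, x⁆ z := by
  rw [← killingForm_lie_left, ← lie_skew, map_neg, LinearMap.neg_apply]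

lemma killingForm_eq_zero_of_grade {i j : ℤ} (hij : i + j ≠ 0) {x y : g} (hx : x ∈ grade b i)
    (hy : y ∈ grade b j) : killingForm ℂ g x y = 0 := by
  simp only [grade, Module.End.mem_eigenspace_iff, LieAlgebra.ad_apply] at hx hy
  have h1 := killingForm_lie_right x (Hgamma b) y
  rw [hx, hy, map_smul, map_smul, LinearMap.smul_apply, smul_eq_mul, smul_eq_mul] at h1
  have h2 : ((i + j : ℤ) : ℂ) * killingForm ℂ g x y = 0 := by push_cast; linear_combination h1
  exact (mul_eq_zero.mp h2).resolve_left (by exact_mod_cast hij)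

lemma Hgamma_mem_grade : Hgamma b ∈ grade b 0 := by
  simp [grade]

lemma killingForm_h_Hgamma (hA : b.A = CartanMatrix.D 4) (i : Fin 4) :
    killingForm ℂ g (b.h i) (Hgamma b) = if i = 1 then killingForm ℂ g (b.e 1) (b.f 1) else 0 := by
  rw [← (b.sl2 i).lie_e_f, killingForm_lie_left, ← lie_skew, lie_f hA]
  split_ifs with h
  · subst h; simp
  · simp

lemma B_lie_left (x y z : g) : B b ⁅x, y⁆ z = B b x ⁅y, z⁆ := by
  simp [B, killingForm, LieModule.traceForm_apply_lie_apply]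

lemma B_lie_right (x y z : g) : B b x ⁅y, z⁆ = -B b ⁅y, x⁆ z := by
  rw [← B_lie_left, ← lie_skew, map_neg, LinearMap.neg_apply]

lemma B_eq_zero_of_grade {i j : ℤ} (hij : i + j ≠ 0) {x y : g} (hx : x ∈ grade b i)
    (hy : y ∈ grade b j) : B b x y = 0 := by
  simp [B, killingForm_eq_zero_of_grade hij hx hy]

lemma B_Hgamma_of_mem_grade {i : ℤ} (hi : i ≠ 0) {x : g} (hx : x ∈ grade b i) :
    B b x (Hgamma b) = 0 :=
  B_eq_zero_of_grade (by simpa using hi) hx Hgamma_mem_grade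

/-- By invariance, since `2 e i = ⁅h i, e i⁆` and `e i` commutes with H_γ. -/
lemma B_e_Hgamma (hA : b.A = CartanMatrix.D 4) {i : Fin 4} (hi : i ≠ 1) :
    B b (b.e i) (Hgamma b) = 0 := by
  have h : (2 : ℂ) • b.e i = ⁅b.h i, b.e i⁆ := ((b.sl2 i).lie_h_e_smul ℂ).symm
  have h2 : (2 : ℂ) * B b (b.e i) (Hgamma b) = 0 := by
    rw [← smul_eq_mul, ← LinearMap.smul_apply, ← map_smul, h, B_lie_left, ← lie_skew, lie_e hA,
      if_neg hi]
    simp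
  simpa using h2

lemma B_f_Hgamma (hA : b.A = CartanMatrix.D 4) {i : Fin 4} (hi : i ≠ 1) :
    B b (b.f i) (Hgamma b) = 0 := by
  have h : (2 : ℂ) • b.f i = -⁅b.h i, b.f i⁆ := by
    rw [(b.sl2 i).lie_lie_smul_f ℂ, neg_neg]
  have h2 : (2 : ℂ) * B b (b.f i) (Hgamma b) = 0 := by
    rw [← smul_eq_mul, ← LinearMap.smul_apply, ← map_smul, h, map_neg, LinearMap.neg_apply,
      B_lie_left, ← lie_skew, lie_f hA, if_neg hi]
    simp
  simpa using h2

variable [FiniteDimensional ℂ g]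

/-- Invariance strips one outer simple root at a time: a root present in both indices contributes
`-1`, a root present in only one of them gives `0`. -/
lemma killingForm_X_X_symm (hA : b.A = CartanMatrix.D 4) (ε δ : RootIdx) :
    killingForm ℂ g (X b ε) (X b.symm δ) = if ε = δ then sign ε * killingForm ℂ g (b.e 1) (b.f 1) else 0 := by
  have comm (x y z : g) : killingForm ℂ g ⁅x, y⁆ z = -killingForm ℂ g y ⁅x, z⁆ := by
    rw [killingForm_lie_right, neg_neg]
  have tt0 (q r q' r' : Bool) : killingForm ℂ g (X b (true, q, r)) (X b.symm (true, q', r')) =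
      -killingForm ℂ g (X b (false, q, r)) (X b.symm (false, q', r')) := by
    have : X b (true, q, r) = ⁅b.e 0, X b (false, q, r)⁆ := by simp [X, adIf]
    rw [this, comm, lie_e_zero_X_symm hA, if_pos rfl]
  have tf0 (q r q' r' : Bool) : killingForm ℂ g (X b (true, q, r)) (X b.symm (false, q', r')) = 0 := by
    have : X b (true, q, r) = ⁅b.e 0, X b (false, q, r)⁆ := by simp [X, adIf]
    rw [this, comm, lie_e_zero_X_symm hA]; simp
  have ft0 (q r q' r' : Bool) : killingForm ℂ g (X b (false, q, r)) (X b.symm (true, q', r')) = 0 := by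
    have : X b.symm (true, q', r') = ⁅b.f 0, X b.symm (false, q', r')⁆ := by simp [X, adIf]
    rw [this, killingForm_lie_right, lie_f_zero_X hA]; simp
  have tt2 (p r p' r' : Bool) : killingForm ℂ g (X b (p, true, r)) (X b.symm (p', true, r')) =
      -killingForm ℂ g (X b (p, false, r)) (X b.symm (p', false, r')) := by
    have : X b (p, true, r) = ⁅b.e 2, X b (p, false, r)⁆ := by simp [lie_e_two_X hA]
    rw [this, comm, lie_e_two_X_symm hA, if_pos rfl]
  have tf2 (p r p' r' : Bool) : killingForm ℂ g (X b (p, true, r)) (X b.symm (p', false, r')) = 0 := by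
    have : X b (p, true, r) = ⁅b.e 2, X b (p, false, r)⁆ := by simp [lie_e_two_X hA]
    rw [this, comm, lie_e_two_X_symm hA]; simp
  have ft2 (p r p' r' : Bool) : killingForm ℂ g (X b (p, false, r)) (X b.symm (p', true, r')) = 0 := by
    have : X b.symm (p', true, r') = ⁅b.f 2, X b.symm (p', false, r')⁆ := by
      simp [lie_f_two_X_symm hA]
    rw [this, killingForm_lie_right, lie_f_two_X hA]; simp
  have tt3 (p q p' q' : Bool) : killingForm ℂ g (X b (p, q, true)) (X b.symm (p', q', true)) =
      -killingForm ℂ g (X b (p, q, false)) (X b.symm (p', q', false)) := by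
    have : X b (p, q, true) = ⁅b.e 3, X b (p, q, false)⁆ := by simp [lie_e_three_X hA]
    rw [this, comm, lie_e_three_X_symm hA, if_pos rfl]
  have tf3 (p q p' q' : Bool) : killingForm ℂ g (X b (p, q, true)) (X b.symm (p', q', false)) = 0 := by
    have : X b (p, q, true) = ⁅b.e 3, X b (p, q, false)⁆ := by simp [lie_e_three_X hA]
    rw [this, comm, lie_e_three_X_symm hA]; simp
  have ft3 (p q p' q' : Bool) : killingForm ℂ g (X b (p, q, false)) (X b.symm (p', q', true)) = 0 := by
    have : X b.symm (p', q', true) = ⁅b.f 3, X b.symm (p', q', false)⁆ := by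
      simp [lie_f_three_X_symm hA]
    rw [this, killingForm_lie_right, lie_f_three_X hA]; simp
  have ff : killingForm ℂ g (X b (false, false, false)) (X b.symm (false, false, false)) =
    killingForm ℂ g (b.e 1) (b.f 1) := by simp [X, adIf]
  obtain ⟨p, q, r⟩ := ε
  obtain ⟨p', q', r'⟩ := δ
  cases p <;> cases p' <;> try simp only [tt0, tf0, ft0]
  all_goals cases q <;> cases q' <;> try simp only [tt2, tf2, ft2, neg_zero]
  all_goals cases r <;> cases r' <;> simp [tt3, tf3, ft3, ff, sign]

variable [LieAlgebra.IsSimple ℂ g]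

/-- The value is twice the pairing of `e 1` with `f 1`. If that vanished, `e 1` would be orthogonal
to g(-1), hence by the grading to all of `g`, against non-degeneracy of the Killing form. This makes
the scaling in `B` meaningful. -/
lemma killingForm_Hgamma_ne_zero (hA : b.A = CartanMatrix.D 4) :
    killingForm ℂ g (Hgamma b) (Hgamma b) ≠ 0 := by
  have h1 : killingForm ℂ g (Hgamma b) (Hgamma b) = 2 * killingForm ℂ g (b.e 1) (b.f 1) := by
    nth_rw 1 [Hgamma]
    simp [killingForm_h_Hgamma hA]
  rw [h1]
  refine mul_ne_zero two_ne_zero fun h ↦ (b.sl2 1).e_ne_zero ?_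
  have hker : b.e 1 ∈ LinearMap.ker (killingForm ℂ g) := by
    refine LinearMap.mem_ker.mpr (LinearMap.ext fun y ↦ ?_)
    have hy : y ∈ Submodule.span ℂ (⋃ k, gradeGen b k) := by simp [span_gradeGen hA]
    induction hy using Submodule.span_induction with
    | zero => simp
    | add x y _ _ h h' => rw [map_add, h, h', map_add]
    | smul t x _ h => rw [map_smul, h, map_smul]
    | mem x hx =>
      obtain ⟨k, hx⟩ := Set.mem_iUnion.mp hx
      by_cases hk : k = -1
      · subst hk
        obtain ⟨ε, rfl⟩ := hx
        have := killingForm_X_X_symm hA (false, false, false) ε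
        rw [h, mul_zero, ite_self] at this
        exact this
      · have hx' : x ∈ grade b k := by
          rw [← span_gradeGen_eq hA]; exact Submodule.subset_span hx
        exact killingForm_eq_zero_of_grade (i := 1) (by omega)
          (X_mem_grade hA (false, false, false)) hx'
  simpa [LieAlgebra.IsKilling.ker_killingForm_eq_bot] using hker

lemma B_e_one_f_one (hA : b.A = CartanMatrix.D 4) : B b (b.e 1) (b.f 1) = 1 := by
  have h1 : B b (Hgamma b) (Hgamma b) = 2 := by
    simp [B, killingForm_Hgamma_ne_zero hA]
  have h2 : B b (Hgamma b) (Hgamma b) = 2 * B b (b.e 1) (b.f 1) := by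
    nth_rw 1 [Hgamma]
    simp [B, killingForm_h_Hgamma hA]
    ring
  linear_combination (h1 - h2) / 2

lemma B_X_X_symm (hA : b.A = CartanMatrix.D 4) (ε δ : RootIdx) :
    B b (X b ε) (X b.symm δ) = if ε = δ then sign ε else 0 := by
  have h := B_e_one_f_one hA
  simp only [B, LinearMap.smul_apply, smul_eq_mul] at h ⊢
  rw [killingForm_X_X_symm hA]
  split_ifs
  · linear_combination sign ε * h
  · simp

lemma B_Xgamma_XnegGamma (hA : b.A = CartanMatrix.D 4) : B b (Xgamma b) (XnegGamma b) = 1 := by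
  have : B b (Xgamma b) (XnegGamma b) = -B b (X b (true, true, true)) ⁅b.e 1, XnegGamma b⁆ := by
    rw [B_lie_right, neg_neg]; rfl
  rw [this, lie_e_XnegGamma hA, if_pos rfl, B_X_X_symm hA]
  simp [sign]

lemma B_Hgamma_Hgamma (hA : b.A = CartanMatrix.D 4) : B b (Hgamma b) (Hgamma b) = 2 := by
  simp [B, killingForm_Hgamma_ne_zero hA]

lemma pairing_X_X (hA : b.A = CartanMatrix.D 4) (p q r p' q' r' : Bool) :
    pairing b (X b (p, q, r)) (X b (p', q', r')) =
      if p' = !p ∧ q' = !q ∧ r' = !r then sign (p, q, r) else 0 := by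
  rw [pairing, lie_X_X hA]
  split_ifs <;> simp [B_Xgamma_XnegGamma hA]

end form

open UniversalEnvelopingAlgebra (ι)

/-! ### Equivariance of ω₂ and ω₃ under the Levi factor -/

section equivariance

variable {g : Type*} [LieRing g] [LieAlgebra ℂ g] {H : LieSubalgebra ℂ g}
  {b : LieAlgebra.Basis (Fin 4) H}

/-- The properties of `T ∈ l` on which the equivariance of `ω₂` and `ω₃` rests: the canonical
element `∑ X_{-ε} ⊗ X_ε` is invariant, and `T` acts on `H_γ`, `X_{-γ}` by `0`, `-dχ(T)`. -/
structure IsLevi (b : LieAlgebra.Basis (Fin 4) H) (T : g) : Prop where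
  sum_eq_zero (Φ : g →ₗ[ℂ] g →ₗ[ℂ] UniversalEnvelopingAlgebra ℂ g) :
    ∑ ε, Φ ⁅T, Xneg b ε⁆ (X b ε) + ∑ ε, Φ (Xneg b ε) ⁅T, X b ε⁆ = 0
  lie_Hgamma : ⁅T, Hgamma b⁆ = 0
  lie_XnegGamma : ⁅T, XnegGamma b⁆ = -B b T (Hgamma b) • XnegGamma b

lemma IsLevi.derivedPart_lie {T : g} (hT : IsLevi b T) (Z : g) :
    derivedPart b ⁅T, Z⁆ = ⁅T, derivedPart b Z⁆ := by
  have h : B b ⁅T, Z⁆ (Hgamma b) = 0 := by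
    rw [← neg_eq_zero, ← B_lie_right, hT.lie_Hgamma, map_zero]
  simp [derivedPart, h, hT.lie_Hgamma]

lemma IsLevi.pairing_lie {T : g} (hT : IsLevi b T) (U W : g) :
    pairing b ⁅T, U⁆ W + pairing b U ⁅T, W⁆ = B b T (Hgamma b) * pairing b U W := by
  have h : B b ⁅T, ⁅U, W⁆⁆ (XnegGamma b) = B b T (Hgamma b) * pairing b U W := by
    have := B_lie_right (b := b) ⁅U, W⁆ T (XnegGamma b)
    rw [hT.lie_XnegGamma, map_smul, smul_eq_mul] at this
    rw [pairing]
    linear_combination this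
  rw [← h, leibniz_lie, map_add, LinearMap.add_apply, pairing, pairing]

lemma pairing_add_left (U V W : g) : pairing b (U + V) W = pairing b U W + pairing b V W := by
  simp [pairing]

lemma pairing_add_right (U V W : g) : pairing b U (V + W) = pairing b U V + pairing b U W := by
  simp [pairing]

lemma pairing_smul_left (t : ℂ) (U V : g) : pairing b (t • U) V = t * pairing b U V := by
  simp [pairing]

lemma pairing_smul_right (t : ℂ) (U V : g) : pairing b U (t • V) = t * pairing b U V := by
  simp [pairing]

lemma derivedPart_add (Z W : g) : derivedPart b (Z + W) = derivedPart b Z + derivedPart b W := by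
  simp only [derivedPart, map_add, LinearMap.add_apply]
  module

lemma derivedPart_smul (t : ℂ) (Z : g) : derivedPart b (t • Z) = t • derivedPart b Z := by
  simp only [derivedPart, map_smul, LinearMap.smul_apply, smul_eq_mul]
  module

lemma omega2_add (Z W : g) : omega2 b (Z + W) = omega2 b Z + omega2 b W := by
  simp only [omega2, derivedPart_add, add_lie, pairing_add_right, add_smul,
    Finset.sum_add_distrib, smul_add]

lemma omega2_smul (t : ℂ) (Z : g) : omega2 b (t • Z) = t • omega2 b Z := by
  simp only [omega2, derivedPart_smul, smul_lie, pairing_smul_right, mul_smul,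
    ← Finset.smul_sum]
  rw [smul_comm]

lemma omega3_add (Y Y' : g) : omega3 b (Y + Y') = omega3 b Y + omega3 b Y' := by
  simp only [omega3, lie_add, omega2_add, mul_add, Finset.sum_add_distrib]

lemma omega3_smul (t : ℂ) (Y : g) : omega3 b (t • Y) = t • omega3 b Y := by
  simp only [omega3, lie_smul, omega2_smul, mul_smul_comm, ← Finset.smul_sum]

lemma omega2_sub (Z W : g) : omega2 b (Z - W) = omega2 b Z - omega2 b W := by
  rw [sub_eq_add_neg, omega2_add, ← neg_one_smul ℂ W, omega2_smul, neg_one_smul, sub_eq_add_neg]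

lemma ι_lie_mul (x u v : g) : ⁅ι ℂ x, ι ℂ u * ι ℂ v⁆ =
    ι ℂ ⁅x, u⁆ * ι ℂ v + ι ℂ u * ι ℂ ⁅x, v⁆ := by
  simp only [LieHom.map_lie, LieRing.of_associative_ring_bracket]
  noncomm_ring

lemma ring_lie_mul {A : Type*} [Ring A] (x u v : A) : ⁅x, u * v⁆ = ⁅x, u⁆ * v + u * ⁅x, v⁆ := by
  simp only [LieRing.of_associative_ring_bracket]
  noncomm_ring

/-- Invariance of the canonical element moves `T` from X_{-α} to X_α (`h1`, with β fixed) and from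
X_{-β} to X_β (`h2`, with α fixed). The pairing is invariant up to the factor dχ(T) (`h3`), which is
the source of the scalar term. -/
lemma IsLevi.lie_omega2 {T : g} (hT : IsLevi b T) (Z : g) :
    ⁅ι ℂ T, omega2 b Z⁆ = omega2 b ⁅T, Z⁆ - B b T (Hgamma b) • omega2 b Z := by
  set W := derivedPart b Z with hW
  have h1 (β : RootIdx) := hT.sum_eq_zero (LinearMap.mk₂ ℂ
    (fun u v ↦ pairing b (X b β) ⁅W, v⁆ • (ι ℂ u * ι ℂ (Xneg b β)))
    (fun u u' v ↦ by rw [map_add, add_mul, smul_add])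
    (fun t u v ↦ by rw [map_smul, smul_mul_assoc, smul_comm])
    (fun u v v' ↦ by rw [lie_add, pairing_add_right, add_smul])
    (fun t u v ↦ by rw [lie_smul, pairing_smul_right, mul_smul]))
  have h2 (α : RootIdx) := hT.sum_eq_zero (LinearMap.mk₂ ℂ
    (fun u v ↦ pairing b v ⁅W, X b α⁆ • (ι ℂ (Xneg b α) * ι ℂ u))
    (fun u u' v ↦ by rw [map_add, mul_add, smul_add])
    (fun t u v ↦ by rw [map_smul, mul_smul_comm, smul_comm])
    (fun u v v' ↦ by rw [pairing_add_left, add_smul])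
    (fun t u v ↦ by rw [pairing_smul_left, mul_smul]))
  simp only [LinearMap.mk₂_apply] at h1 h2
  have h1' := Finset.sum_congr rfl fun β (_ : β ∈ Finset.univ) ↦ h1 β
  have h2' := Finset.sum_congr rfl fun α (_ : α ∈ Finset.univ) ↦ h2 α
  rw [Finset.sum_add_distrib, Finset.sum_comm, Finset.sum_comm (γ := RootIdx) (s := Finset.univ)
    (f := fun β α ↦ pairing b (X b β) ⁅W, ⁅T, X b α⁆⁆ • _), Finset.sum_const_zero] at h1'
  rw [Finset.sum_add_distrib, Finset.sum_const_zero] at h2'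
  have h3 (α β : RootIdx) : pairing b (X b β) ⁅⁅T, W⁆, X b α⁆ =
      B b T (Hgamma b) * pairing b (X b β) ⁅W, X b α⁆ - pairing b ⁅T, X b β⁆ ⁅W, X b α⁆
        - pairing b (X b β) ⁅W, ⁅T, X b α⁆⁆ := by
    have := hT.pairing_lie (X b β) ⁅W, X b α⁆
    rw [leibniz_lie T W, pairing_add_right] at this
    linear_combination this
  simp only [omega2, hT.derivedPart_lie, ← hW, h3, sub_smul, lie_smul, lie_sum,
    ι_lie_mul, smul_add, Finset.sum_add_distrib, Finset.sum_sub_distrib]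
  simp only [mul_smul, ← Finset.smul_sum]
  rw [eq_neg_of_add_eq_zero_left h1', eq_neg_of_add_eq_zero_left h2']
  module

/-- One more contraction with the canonical element; the scalar term is inherited from ω₂. -/
lemma IsLevi.lie_omega3 {T : g} (hT : IsLevi b T) (Y : g) :
    ⁅ι ℂ T, omega3 b Y⁆ = omega3 b ⁅T, Y⁆ - B b T (Hgamma b) • omega3 b Y := by
  have h1 := hT.sum_eq_zero (LinearMap.mk₂ ℂ
    (fun u v ↦ ι ℂ u * omega2 b ⁅v, Y⁆)
    (fun u u' v ↦ by rw [map_add, add_mul])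
    (fun t u v ↦ by rw [map_smul, smul_mul_assoc])
    (fun u v v' ↦ by rw [add_lie, omega2_add, mul_add])
    (fun t u v ↦ by rw [smul_lie, omega2_smul, mul_smul_comm]))
  simp only [LinearMap.mk₂_apply] at h1
  have h2 (ε : RootIdx) : ⁅X b ε, ⁅T, Y⁆⁆ = ⁅T, ⁅X b ε, Y⁆⁆ - ⁅⁅T, X b ε⁆, Y⁆ := by
    rw [leibniz_lie T, add_sub_cancel_left]
  simp only [omega3, lie_sum, ring_lie_mul, ← LieHom.map_lie, hT.lie_omega2, h2, omega2_sub,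
    mul_sub, Finset.sum_add_distrib, Finset.sum_sub_distrib, mul_smul_comm]
  rw [eq_neg_of_add_eq_zero_left h1, Finset.smul_sum]
  abel

variable [FiniteDimensional ℂ g]

lemma isLevi_h [LieAlgebra.IsSimple ℂ g] (hA : b.A = CartanMatrix.D 4) (i : Fin 4) :
    IsLevi b (b.h i) where
  sum_eq_zero Φ := by
    rw [← Finset.sum_add_distrib]
    refine Finset.sum_eq_zero fun ε _ ↦ ?_
    obtain ⟨p, q, r⟩ := ε
    simp only [Xneg_eq, lie_smul]
    fin_cases i
    · simp only [Fin.zero_eta, lie_h_zero_X hA, lie_h_zero_X_symm hA, map_smul, LinearMap.smul_apply]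
      split_ifs <;> module
    · simp only [Fin.mk_one, lie_h_one_X hA, lie_h_one_X_symm hA, map_smul, LinearMap.smul_apply]
      module
    · simp only [Fin.reduceFinMk, lie_h_two_X hA, lie_h_two_X_symm hA, map_smul,
        LinearMap.smul_apply]
      split_ifs <;> module
    · simp only [Fin.reduceFinMk, lie_h_three_X hA, lie_h_three_X_symm hA, map_smul,
        LinearMap.smul_apply]
      split_ifs <;> module
  lie_Hgamma := by simp [Hgamma, b.lie_h_h]
  lie_XnegGamma := by
    rw [lie_h_XnegGamma hA]
    have h1 := killingForm_h_Hgamma hA i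
    simp only [B, LinearMap.smul_apply, h1]
    have h2 := B_e_one_f_one hA
    simp only [B, LinearMap.smul_apply] at h2
    split_ifs
    · rw [h2]
    · simp

lemma isLevi_e (hA : b.A = CartanMatrix.D 4) {i : Fin 4} (hi : i ≠ 1) :
    IsLevi b (b.e i) where
  sum_eq_zero Φ := by
    fin_cases i
    · simp [Fintype.sum_prod_type, Xneg_eq, lie_e_zero_X hA, lie_e_zero_X_symm hA, sign, -lie_skew]
      abel
    · exact (hi rfl).elim
    · simp [Fintype.sum_prod_type, Xneg_eq, lie_e_two_X hA, lie_e_two_X_symm hA, sign, -lie_skew]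
      abel
    · simp [Fintype.sum_prod_type, Xneg_eq, lie_e_three_X hA, lie_e_three_X_symm hA, sign, -lie_skew]
      abel
  lie_Hgamma := by rw [← lie_skew, lie_e hA, if_neg hi]; simp
  lie_XnegGamma := by rw [lie_e_XnegGamma hA, if_neg hi, B_e_Hgamma hA hi]; simp

lemma isLevi_f (hA : b.A = CartanMatrix.D 4) {i : Fin 4} (hi : i ≠ 1) :
    IsLevi b (b.f i) where
  sum_eq_zero Φ := by
    fin_cases i
    · simp [Fintype.sum_prod_type, Xneg_eq, lie_f_zero_X hA, lie_f_zero_X_symm hA, sign, -lie_skew]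
      abel
    · exact (hi rfl).elim
    · simp [Fintype.sum_prod_type, Xneg_eq, lie_f_two_X hA, lie_f_two_X_symm hA, sign, -lie_skew]
      abel
    · simp [Fintype.sum_prod_type, Xneg_eq, lie_f_three_X hA, lie_f_three_X_symm hA, sign, -lie_skew]
      abel
  lie_Hgamma := by rw [← lie_skew, lie_f hA, if_neg hi]; simp
  lie_XnegGamma := by rw [lie_f_XnegGamma hA, B_f_Hgamma hA hi]; simp

end equivariance

/-! ### Explicit formulas for ω₂ and for ω₃(f₁) -/

section explicit

variable {g : Type*} [LieRing g] [LieAlgebra ℂ g] {H : LieSubalgebra ℂ g}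
  {b : LieAlgebra.Basis (Fin 4) H}

lemma pairing_zero_right (U : g) : pairing b U 0 = 0 := by simp [pairing]

lemma omega2_zero : omega2 b 0 = 0 := by
  simpa using omega2_smul (b := b) 0 0

lemma derivedPart_e (hA : b.A = CartanMatrix.D 4) {i : Fin 4} (hi : i ≠ 1) :
    derivedPart b (b.e i) = b.e i := by
  simp [derivedPart, B_e_Hgamma hA hi]

variable [FiniteDimensional ℂ g]

lemma ι_mul_ι_X_symm (hA : b.A = CartanMatrix.D 4) (p q r p' q' r' : Bool) :
    ι ℂ (X b.symm (p, q, r)) * ι ℂ (X b.symm (p', q', r')) =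
      ι ℂ (X b.symm (p', q', r')) * ι ℂ (X b.symm (p, q, r)) +
        if p' = !p ∧ q' = !q ∧ r' = !r then sign (p, q, r) • ι ℂ (XnegGamma b) else 0 := by
  rw [← sub_eq_iff_eq_add', ← LieRing.of_associative_ring_bracket, ← LieHom.map_lie,
    lie_X_X_symm hA]
  split_ifs <;> simp

lemma lie_X_f_one (hA : b.A = CartanMatrix.D 4) (ε : RootIdx) :
    ⁅X b ε, b.f 1⁆ = match ε with
      | (false, false, false) => b.h 1
      | (true, false, false) => b.e 0
      | (false, true, false) => b.e 2
      | (false, false, true) => b.e 3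
      | _ => 0 := by
  rw [← lie_skew, lie_f_one_X hA]
  obtain ⟨p, q, r⟩ := ε
  cases p <;> cases q <;> cases r <;> simp

variable [LieAlgebra.IsSimple ℂ g]

/-- Since dχ(h₁) = 1, the projection subtracts half of H_γ. As H_γ acts by 1 on V⁺, the constant 2
of `lie_h_one_X` becomes 3/2. -/
lemma lie_derivedPart_h_one_X (hA : b.A = CartanMatrix.D 4) (p q r : Bool) :
    ⁅derivedPart b (b.h 1), X b (p, q, r)⁆ = (3 / 2 - (if p then 1 else 0) - (if q then 1 else 0) -
      (if r then 1 else 0) : ℂ) • X b (p, q, r) := by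
  have h1 : B b (b.h 1) (Hgamma b) = 1 := by
    have h1 := killingForm_h_Hgamma hA 1
    have h2 := B_e_one_f_one hA
    simp only [B, LinearMap.smul_apply] at h2 ⊢
    rw [h1, if_pos rfl, h2]
  have h2 := X_mem_grade hA (p, q, r)
  simp only [grade, Module.End.mem_eigenspace_iff, LieAlgebra.ad_apply] at h2
  rw [derivedPart, h1, sub_lie, smul_lie, h2, lie_h_one_X hA]
  push_cast
  module

lemma omega2_e_zero (hA : b.A = CartanMatrix.D 4) :
    omega2 b (b.e 0) =
      ι ℂ (X b.symm (false, true, false)) * ι ℂ (X b.symm (false, false, true)) -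
        ι ℂ (X b.symm (false, false, false)) * ι ℂ (X b.symm (false, true, true)) := by
  rw [omega2, derivedPart_e hA (by decide)]
  simp [Fintype.sum_prod_type, lie_e_zero_X hA, pairing_X_X hA, Xneg_eq, sign, pairing_zero_right,
    -UniversalEnvelopingAlgebra.ι_apply]
  -- Each monomial occurs for (α, β) and for (β, α). These root vectors commute, so the two
  -- occurrences merge and absorb the factor 1/2.
  rw [ι_mul_ι_X_symm hA false false true false true false,
    ι_mul_ι_X_symm hA false true true false false false]
  simp only [Bool.not_false, Bool.not_true, Bool.false_eq_true, false_and, if_false,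
    add_zero]
  module

lemma omega2_e_two (hA : b.A = CartanMatrix.D 4) :
    omega2 b (b.e 2) =
      ι ℂ (X b.symm (true, false, false)) * ι ℂ (X b.symm (false, false, true)) -
        ι ℂ (X b.symm (false, false, false)) * ι ℂ (X b.symm (true, false, true)) := by
  rw [omega2, derivedPart_e hA (by decide)]
  simp [Fintype.sum_prod_type, lie_e_two_X hA, pairing_X_X hA, Xneg_eq, sign, pairing_zero_right,
    -UniversalEnvelopingAlgebra.ι_apply]
  rw [ι_mul_ι_X_symm hA false false true true false false,
    ι_mul_ι_X_symm hA true false true false false false]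
  simp only [Bool.not_false, Bool.not_true, Bool.false_eq_true, and_false, false_and, if_false,
    add_zero]
  module

lemma omega2_e_three (hA : b.A = CartanMatrix.D 4) :
    omega2 b (b.e 3) =
      ι ℂ (X b.symm (true, false, false)) * ι ℂ (X b.symm (false, true, false)) -
        ι ℂ (X b.symm (false, false, false)) * ι ℂ (X b.symm (true, true, false)) := by
  rw [omega2, derivedPart_e hA (by decide)]
  simp [Fintype.sum_prod_type, lie_e_three_X hA, pairing_X_X hA, Xneg_eq, sign, pairing_zero_right,
    -UniversalEnvelopingAlgebra.ι_apply]
  rw [ι_mul_ι_X_symm hA false true false true false false,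
    ι_mul_ι_X_symm hA true true false false false false]
  simp only [Bool.not_false, Bool.not_true, Bool.false_eq_true, and_false, if_false,
    add_zero]
  module

lemma omega2_h_one (hA : b.A = CartanMatrix.D 4) :
    omega2 b (b.h 1) = (1 / 2 : ℂ) •
      (ι ℂ (X b.symm (true, false, false)) * ι ℂ (X b.symm (false, true, true)) +
        ι ℂ (X b.symm (false, true, false)) * ι ℂ (X b.symm (true, false, true)) +
        ι ℂ (X b.symm (false, false, true)) * ι ℂ (X b.symm (true, true, false))) +
      (3 / 2 : ℂ) • (ι ℂ (XnegGamma b) -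
        ι ℂ (X b.symm (false, false, false)) * ι ℂ (X b.symm (true, true, true))) := by
  rw [omega2]
  simp [Fintype.sum_prod_type, lie_derivedPart_h_one_X hA, pairing_smul_right,
    pairing_X_X hA, Xneg_eq, sign, -UniversalEnvelopingAlgebra.ι_apply]
  -- Here the two roots of each monomial add up to -γ, so the reordering does produce multiples of
  -- X_{-γ}.
  rw [ι_mul_ι_X_symm hA true true true false false false,
    ι_mul_ι_X_symm hA true true false false false true,
    ι_mul_ι_X_symm hA true false true false true false,
    ι_mul_ι_X_symm hA false true true true false false]
  simp [sign, -UniversalEnvelopingAlgebra.ι_apply]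
  module

/-- Only ε = α₁ and ε = α₁ + α_i (`i` outer) contribute, through ω₂(h₁) and ω₂(e_i). The common
factor 3/2 is 1 + 1/2 on the mixed monomials; the last monomial comes once from each of the three
e_i, with total coefficient -3. -/
lemma omega3_f_one (hA : b.A = CartanMatrix.D 4) :
    omega3 b (b.f 1) = (3 / 2 : ℂ) • (
      ι ℂ (X b.symm (false, false, false)) * (ι ℂ (X b.symm (true, false, false)) *
        ι ℂ (X b.symm (false, true, true))) +
      ι ℂ (X b.symm (false, false, false)) * (ι ℂ (X b.symm (false, true, false)) *
        ι ℂ (X b.symm (true, false, true))) +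
      ι ℂ (X b.symm (false, false, false)) * (ι ℂ (X b.symm (false, false, true)) *
        ι ℂ (X b.symm (true, true, false))) +
      ι ℂ (X b.symm (false, false, false)) * ι ℂ (XnegGamma b) -
      ι ℂ (X b.symm (false, false, false)) * (ι ℂ (X b.symm (false, false, false)) *
        ι ℂ (X b.symm (true, true, true))) -
      (2 : ℂ) • (ι ℂ (X b.symm (true, false, false)) * (ι ℂ (X b.symm (false, true, false)) *
        ι ℂ (X b.symm (false, false, true))))) := by
  have h1 := ι_mul_ι_X_symm hA true false false false false false
  have h2 := ι_mul_ι_X_symm hA false true false false false false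
  have h3 := ι_mul_ι_X_symm hA false false true false false false
  have h4 := ι_mul_ι_X_symm hA false true false true false false
  have h5 := ι_mul_ι_X_symm hA false false true true false false
  have h6 := ι_mul_ι_X_symm hA false false true false true false
  simp only [Bool.not_false, Bool.not_true, Bool.false_eq_true, and_false,
    false_and, if_false, add_zero] at h1 h2 h3 h4 h5 h6
  rw [omega3]
  simp only [Fintype.sum_prod_type, Fintype.sum_bool, lie_X_f_one hA, omega2_e_zero hA,
    omega2_e_two hA, omega2_e_three hA, omega2_h_one hA, omega2_zero, mul_zero, Xneg_eq,
    sign, map_smul, smul_mul_assoc, mul_add, mul_sub, mul_smul_comm, if_true, if_false,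
    Bool.false_eq_true, ← mul_assoc, h1, h2, h3, h4]
  simp only [mul_assoc, h5, h6]
  simp only [← mul_assoc]
  module

end explicit

end HeisenbergD4

/-! ### Calculus in a generalized Verma module -/

section genVerma

attribute [local instance] LieRing.ofAssociativeRing

variable {g : Type*} [LieRing g] [LieAlgebra ℂ g] (q : LieSubalgebra ℂ g)
  {F : Type*} [AddCommGroup F] [Module ℂ F] [LieRingModule q F] [LieModule ℂ q F]

lemma GenVerma.lie_def (x : g) (m : GenVerma q F) :
    ⁅x, m⁆ = UniversalEnvelopingAlgebra.ι ℂ x • m := rfl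

lemma GenVerma.smul_mk (u u' : UniversalEnvelopingAlgebra ℂ g) (f : F) :
    u • GenVerma.mk q u' f = GenVerma.mk q (u * u') f := rfl

lemma GenVerma.mk_mul_ι (u : UniversalEnvelopingAlgebra ℂ g) (a : q) (f : F) :
    GenVerma.mk q (u * UniversalEnvelopingAlgebra.ι ℂ (a : g)) f = GenVerma.mk q u ⁅a, f⁆ :=
  (Submodule.Quotient.eq _).mpr (Submodule.subset_span ⟨u, a, f, rfl⟩)

lemma GenVerma.mk_smul (t : ℂ) (u : UniversalEnvelopingAlgebra ℂ g) (f : F) :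
    GenVerma.mk q u (t • f) = t • GenVerma.mk q u f := by
  rw [GenVerma.mk, TensorProduct.tmul_smul]
  rfl

end genVerma

namespace HeisenbergD4

attribute [local instance] LieRing.ofAssociativeRing

open UniversalEnvelopingAlgebra (ι)

/-! ### E is a q-submodule annihilated by n -/

section submodule

variable {g : Type*} [LieRing g] [LieAlgebra ℂ g] {H : LieSubalgebra ℂ g}
  {b : LieAlgebra.Basis (Fin 4) H} (hA : b.A = CartanMatrix.D 4)

/-- The generator `1 ⊗ 1` of `M(ℂ_{-dχ})`. -/
def vac : M b hA := GenVerma.mk (q b) 1 (ScalarModule.one (-1) (dchi b hA))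

lemma mk_one_eq (u : UniversalEnvelopingAlgebra ℂ g) :
    GenVerma.mk (q b) u (ScalarModule.one (-1) (dchi b hA)) = u • vac hA := by
  rw [vac, GenVerma.smul_mk, mul_one]

lemma lie_vac {x : g} (hx : x ∈ q b) : ⁅x, vac hA⁆ = -B b x (Hgamma b) • vac hA := by
  rw [GenVerma.lie_def, ← mk_one_eq, vac, ← GenVerma.mk_smul]
  have := GenVerma.mk_mul_ι (q b) 1 ⟨x, hx⟩ (ScalarModule.one (-1) (dchi b hA))
  rw [one_mul] at this
  rw [this]
  congr 1
  change (-1 * B b x (Hgamma b)) • ScalarModule.one (-1) (dchi b hA) = _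
  rw [neg_one_mul]

lemma e_mem_q (i : Fin 4) : b.e i ∈ q b :=
  LieSubalgebra.subset_lieSpan (Or.inl (Or.inr ⟨i, rfl⟩))

include hA in
lemma f_mem_q {i : Fin 4} (hi : i ≠ 1) : b.f i ∈ q b :=
  LieSubalgebra.subset_lieSpan (Or.inr ⟨i, by rw [lie_e hA, if_neg hi, zero_smul], rfl⟩)

lemma h_mem_q (i : Fin 4) : b.h i ∈ q b :=
  LieSubalgebra.subset_lieSpan (Or.inl (Or.inl (b.h' i).2))

lemma lie_e_vac (i : Fin 4) : ⁅b.e i, vac hA⁆ = 0 := by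
  rw [lie_vac hA (e_mem_q i)]
  by_cases hi : i = 1
  · subst hi
    have : b.e 1 ∈ grade b 1 := X_mem_grade hA (false, false, false)
    rw [B_Hgamma_of_mem_grade one_ne_zero this, neg_zero, zero_smul]
  · rw [B_e_Hgamma hA hi, neg_zero, zero_smul]

lemma lie_f_vac {i : Fin 4} (hi : i ≠ 1) : ⁅b.f i, vac hA⁆ = 0 := by
  rw [lie_vac hA (f_mem_q hA hi), B_f_Hgamma hA hi, neg_zero, zero_smul]

lemma omega3_smul_mem {Y : g} (hY : Y ∈ grade b (-1)) :
    omega3 b Y • vac hA ∈ omega3Span b hA :=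
  Submodule.subset_span ⟨Y, hY, (mk_one_eq hA _).symm⟩

/-- One dχ(T) comes from the equivariance of ω₃, the other from the action of `T` on the generator;
hence the factor 2. -/
lemma IsLevi.lie_omega3_smul_vac {T : g} (hT : IsLevi b T) (hq : T ∈ q b) (Y : g) :
    ⁅T, omega3 b Y • vac hA⁆ =
      (omega3 b ⁅T, Y⁆ - (2 * B b T (Hgamma b)) • omega3 b Y) • vac hA := by
  have h1 : ι ℂ T * omega3 b Y = ⁅ι ℂ T, omega3 b Y⁆ + omega3 b Y * ι ℂ T := by
    rw [LieRing.of_associative_ring_bracket, sub_add_cancel]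
  rw [GenVerma.lie_def, ← mul_smul, h1, add_smul, mul_smul, ← GenVerma.lie_def, lie_vac hA hq,
    hT.lie_omega3, smul_comm (omega3 b Y), ← smul_assoc, ← add_smul]
  congr 1
  module

lemma IsLevi.lie_mem_omega3Span {T : g} (hT : IsLevi b T) (hq : T ∈ q b) (h0 : T ∈ grade b 0)
    {m : M b hA} (hm : m ∈ omega3Span b hA) : ⁅T, m⁆ ∈ omega3Span b hA := by
  induction hm using Submodule.span_induction with
  | zero => simp
  | add x y _ _ hx hy => rw [lie_add]; exact add_mem hx hy
  | smul t x _ hx => rw [lie_smul]; exact Submodule.smul_mem _ t hx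
  | mem m hm =>
    obtain ⟨Y, hY, rfl⟩ := hm
    rw [mk_one_eq, hT.lie_omega3_smul_vac hA hq, sub_smul, smul_assoc]
    refine sub_mem (omega3_smul_mem hA ?_) (Submodule.smul_mem _ _ (omega3_smul_mem hA hY))
    simpa using lie_mem_grade h0 hY

variable [FiniteDimensional ℂ g]

include hA in
lemma gradeGen_subset_grade (k : ℤ) : gradeGen b k ⊆ grade b k := by
  rw [← span_gradeGen_eq hA]
  exact Submodule.subset_span

variable [LieAlgebra.IsSimple ℂ g]

include hA in
lemma B_h_Hgamma (i : Fin 4) : B b (b.h i) (Hgamma b) = if i = 1 then 1 else 0 := by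
  have h1 := killingForm_h_Hgamma hA i
  have h2 := B_e_one_f_one hA
  simp only [B, LinearMap.smul_apply] at h2 ⊢
  rw [h1]
  split_ifs
  · exact h2
  · simp

lemma lie_h_vac (i : Fin 4) : ⁅b.h i, vac hA⁆ = (if i = 1 then -1 else 0 : ℂ) • vac hA := by
  rw [lie_vac hA (h_mem_q i), B_h_Hgamma hA]
  split_ifs <;> simp

/-- This is where the parameter matters. If `h 1` acted on the generator by -s, the result would be
a combination of X_{-α₁-α_i} X_{-(γ-α₁-α_i)}, X_{-γ} and X_{-α₁} X_{-(γ-α₁)} with all coefficients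
multiples of 1 - s; here s = 1. -/
lemma lie_e_one_omega3_f_one : ⁅b.e 1, omega3 b (b.f 1) • vac hA⁆ = 0 := by
  have hc : ⁅X b.symm (false, false, true), ⁅X b.symm (true, true, false), vac hA⁆⁆ =
      ⁅X b.symm (true, true, false), ⁅X b.symm (false, false, true), vac hA⁆⁆
        - ⁅XnegGamma b, vac hA⁆ := by
    rw [leibniz_lie (X b.symm (false, false, true)), lie_X_X_symm hA]
    simp [sign, -lie_skew]
    abel
  rw [omega3_f_one hA, smul_assoc, lie_smul]
  simp only [add_smul, sub_smul, mul_smul, smul_assoc, ← GenVerma.lie_def, lie_add, lie_sub,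
    lie_smul, leibniz_lie (b.e 1), lie_e_vac, lie_e_one_X_symm hA, lie_e_XnegGamma hA]
  simp only [leibniz_lie (b.h 1), leibniz_lie (b.f 0), leibniz_lie (b.f 2), leibniz_lie (b.f 3),
    lie_h_vac, lie_f_vac hA (show (0 : Fin 4) ≠ 1 by decide),
    lie_f_vac hA (show (2 : Fin 4) ≠ 1 by decide), lie_f_vac hA (show (3 : Fin 4) ≠ 1 by decide),
    lie_h_one_X_symm hA, lie_f_zero_X_symm hA, lie_f_two_X_symm hA, lie_f_three_X_symm hA,
    lie_h_XnegGamma hA, lie_zero, zero_lie, add_zero, neg_lie, lie_neg, if_true, if_false,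
    Bool.false_eq_true, lie_smul, smul_lie]
  simp only [lie_add, lie_smul, hc]
  module

lemma lie_e_one_omega3 {Y : g} (hY : Y ∈ grade b (-1)) :
    ⁅b.e 1, omega3 b Y • vac hA⁆ = 0 := by
  -- As dχ(f i) = 0, passing from `Y` to `⁅f i, Y⁆` is the action of `f i` on the vector, and `f i`
  -- commutes with `e 1`.
  have step {i : Fin 4} (hi : i ≠ 1) {Y : g} (h : ⁅b.e 1, omega3 b Y • vac hA⁆ = 0) :
      ⁅b.e 1, omega3 b ⁅b.f i, Y⁆ • vac hA⁆ = 0 := by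
    have := (isLevi_f hA hi).lie_omega3_smul_vac hA (f_mem_q hA hi) Y
    rw [B_f_Hgamma hA hi, mul_zero, zero_smul, sub_zero] at this
    rw [← this, leibniz_lie, h, b.lie_e_f_ne _ _ hi.symm, zero_lie, lie_zero, add_zero]
  rw [← span_gradeGen_eq hA] at hY
  induction hY using Submodule.span_induction with
  | zero =>
    have : omega3 b 0 = 0 := by simpa using omega3_smul (b := b) 0 0
    rw [this, zero_smul, lie_zero]
  | add x y _ _ h h' => rw [omega3_add, add_smul, lie_add, h, h', add_zero]
  | smul t x _ h => rw [omega3_smul, smul_assoc, lie_smul, h, smul_zero]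
  | mem x hx =>
    obtain ⟨⟨p, q, r⟩, rfl⟩ := hx
    have h0 := lie_e_one_omega3_f_one hA
    have s0 {Y : g} := step (i := 0) (by decide) (Y := Y)
    have s2 {Y : g} := step (i := 2) (by decide) (Y := Y)
    have s3 {Y : g} := step (i := 3) (by decide) (Y := Y)
    cases p <;> cases q <;> cases r
    exacts [h0, s3 h0, s2 h0, s2 (s3 h0), s0 h0, s0 (s3 h0), s0 (s2 h0), s0 (s2 (s3 h0))]

lemma lie_e_one_omega3Span {m : M b hA} (hm : m ∈ omega3Span b hA) : ⁅b.e 1, m⁆ = 0 := by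
  induction hm using Submodule.span_induction with
  | zero => simp
  | add x y _ _ hx hy => rw [lie_add, hx, hy, add_zero]
  | smul t x _ hx => rw [lie_smul, hx, smul_zero]
  | mem m hm => obtain ⟨Y, hY, rfl⟩ := hm; rw [mk_one_eq]; exact lie_e_one_omega3 hA hY

lemma lie_e_mem_omega3Span (i : Fin 4) {m : M b hA} (hm : m ∈ omega3Span b hA) :
    ⁅b.e i, m⁆ ∈ omega3Span b hA := by
  by_cases hi : i = 1
  · subst hi
    rw [lie_e_one_omega3Span hA hm]
    exact zero_mem _
  · exact (isLevi_e hA hi).lie_mem_omega3Span hA (e_mem_q i)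
      (gradeGen_subset_grade hA 0 (Or.inl (Or.inr ⟨i, hi, rfl⟩))) hm

lemma lie_mem_omega3Span {x : g} (hx : x ∈ q b) {m : M b hA} (hm : m ∈ omega3Span b hA) :
    ⁅x, m⁆ ∈ omega3Span b hA := by
  induction hx using LieSubalgebra.lieSpan_induction generalizing m with
  | zero => simp
  | add u v _ _ hu hv => rw [add_lie]; exact add_mem (hu hm) (hv hm)
  | smul t u _ hu => rw [smul_lie]; exact Submodule.smul_mem _ t (hu hm)
  | lie u v _ _ hu hv => rw [lie_lie]; exact sub_mem (hu (hv hm)) (hv (hu hm))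
  | mem u hu =>
    rcases hu with (hu | ⟨i, rfl⟩) | ⟨i, hi, rfl⟩
    · have hu' : u ∈ Submodule.span ℂ (Set.range b.h) := by
        rw [← b.coe_cartan_eq_span]; exact hu
      clear hu
      induction hu' using Submodule.span_induction with
      | zero => simp
      | add u v _ _ hu hv => rw [add_lie]; exact add_mem hu hv
      | smul t u _ hu => rw [smul_lie]; exact Submodule.smul_mem _ t hu
      | mem v hv =>
        obtain ⟨i, rfl⟩ := hv
        exact (isLevi_h hA i).lie_mem_omega3Span hA (h_mem_q i)
          (gradeGen_subset_grade hA 0 (Or.inl (Or.inl ⟨i, rfl⟩))) hm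
    · exact lie_e_mem_omega3Span hA i hm
    · have hi : i ≠ 1 := by
        rintro rfl
        rw [lie_e hA] at hi
        exact (b.sl2 1).e_ne_zero (by simpa using hi)
      exact (isLevi_f hA hi).lie_mem_omega3Span hA (f_mem_q hA hi)
        (gradeGen_subset_grade hA 0 (Or.inr ⟨i, hi, rfl⟩)) hm

/-- Each `e i` preserves E, so the annihilator of E in `g` is stable under `ad (e i)`. It contains
`e 1`, hence all X_ε and X_γ. -/
lemma lie_eq_zero_of_mem_n {x : g} (hx : x ∈ n b) {m : M b hA} (hm : m ∈ omega3Span b hA) :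
    ⁅x, m⁆ = 0 := by
  have step {x : g} (i : Fin 4) (hx : ∀ m ∈ omega3Span b hA, ⁅x, m⁆ = 0) :
      ∀ m ∈ omega3Span b hA, ⁅⁅b.e i, x⁆, m⁆ = 0 := fun m hm ↦ by
    rw [lie_lie, hx m hm, hx _ (lie_e_mem_omega3Span hA i hm), lie_zero, sub_zero]
  have h0 : ∀ m ∈ omega3Span b hA, ⁅b.e 1, m⁆ = 0 := fun m hm ↦ lie_e_one_omega3Span hA hm
  have hX (ε : RootIdx) : ∀ m ∈ omega3Span b hA, ⁅X b ε, m⁆ = 0 := by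
    obtain ⟨p, q, r⟩ := ε
    cases p <;> cases q <;> cases r
    exacts [h0, step 3 h0, step 2 h0, step 2 (step 3 h0), step 0 h0, step 0 (step 3 h0),
      step 0 (step 2 h0), step 0 (step 2 (step 3 h0))]
  have hspan {s : Set g} (hs : ∀ y ∈ s, ⁅y, m⁆ = 0) {y : g} (hy : y ∈ Submodule.span ℂ s) :
      ⁅y, m⁆ = 0 := by
    induction hy using Submodule.span_induction with
    | mem y hy => exact hs y hy
    | zero => simp
    | add u v _ _ hu hv => rw [add_lie, hu, hv, add_zero]
    | smul t u _ hu => rw [smul_lie, hu, smul_zero]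
  obtain ⟨y, hy, z, hz, rfl⟩ := Submodule.mem_sup.mp hx
  rw [← span_gradeGen_eq hA] at hy hz
  rw [add_lie, hspan _ hy, hspan _ hz, add_zero]
  · intro y hy
    rw [Set.mem_singleton_iff.mp hy]
    exact step 1 (hX _) m hm
  · rintro _ ⟨ε, rfl⟩
    exact hX ε m hm

end submodule

end HeisenbergD4

/-! ### Subspaces stable under g are stable under U(g) -/

section envelopingAlgebra

attribute [local instance] LieRing.ofAssociativeRing

variable {g : Type*} [LieRing g] [LieAlgebra ℂ g]

/-- By the universal property, lifting `ι` to the subalgebra it generates and then including back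
gives the identity. -/
lemma UniversalEnvelopingAlgebra.adjoin_range_ι :
    Algebra.adjoin ℂ (Set.range (UniversalEnvelopingAlgebra.ι ℂ : g → _)) = ⊤ := by
  set S := Algebra.adjoin ℂ (Set.range (UniversalEnvelopingAlgebra.ι ℂ : g → _))
  let f : g →ₗ⁅ℂ⁆ S :=
    { toFun := fun x ↦ ⟨UniversalEnvelopingAlgebra.ι ℂ x, Algebra.subset_adjoin ⟨x, rfl⟩⟩
      map_add' := fun x y ↦ Subtype.ext (map_add _ x y)
      map_smul' := fun t x ↦ Subtype.ext (map_smul _ t x)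
      map_lie' := fun {x y} ↦ Subtype.ext (LieHom.map_lie _ x y) }
  have h : S.val.comp (UniversalEnvelopingAlgebra.lift ℂ f) = AlgHom.id ℂ _ := by
    refine UniversalEnvelopingAlgebra.hom_ext (R := ℂ) (LieHom.ext fun x ↦ ?_)
    change S.val (UniversalEnvelopingAlgebra.lift ℂ f (UniversalEnvelopingAlgebra.ι ℂ x)) = _
    rw [UniversalEnvelopingAlgebra.lift_ι_apply]
    rfl
  refine eq_top_iff.mpr fun u _ ↦ ?_
  have := DFunLike.congr_fun h u
  rw [AlgHom.id_apply] at this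
  rw [← this]
  exact (UniversalEnvelopingAlgebra.lift ℂ f u).2

lemma UniversalEnvelopingAlgebra.map_mem {V : Type*} [AddCommGroup V] [Module ℂ V]
    (φ : UniversalEnvelopingAlgebra ℂ g →ₐ[ℂ] Module.End ℂ V) (P : Submodule ℂ V)
    (hP : ∀ x, ∀ m ∈ P, φ (UniversalEnvelopingAlgebra.ι ℂ x) m ∈ P)
    (u : UniversalEnvelopingAlgebra ℂ g) : ∀ m ∈ P, φ u m ∈ P := by
  have hu : u ∈ Algebra.adjoin ℂ (Set.range (UniversalEnvelopingAlgebra.ι ℂ : g → _)) := by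
    rw [adjoin_range_ι]; trivial
  induction hu using Algebra.adjoin_induction with
  | mem x hx => obtain ⟨y, rfl⟩ := hx; exact hP y
  | algebraMap t => intro m hm; rw [AlgHom.commutes]; exact P.smul_mem t hm
  | add u v _ _ hu hv => intro m hm; rw [map_add]; exact add_mem (hu m hm) (hv m hm)
  | mul u v _ _ hu hv => intro m hm; rw [map_mul]; exact hu _ (hv m hm)

lemma UniversalEnvelopingAlgebra.smul_mem {V : Type*} [AddCommGroup V] [Module ℂ V]
    [Module (UniversalEnvelopingAlgebra ℂ g) V]
    [IsScalarTower ℂ (UniversalEnvelopingAlgebra ℂ g) V] (P : Submodule ℂ V)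
    (hP : ∀ x, ∀ m ∈ P, UniversalEnvelopingAlgebra.ι ℂ (x : g) • m ∈ P)
    (u : UniversalEnvelopingAlgebra ℂ g) : ∀ m ∈ P, u • m ∈ P :=
  map_mem (Algebra.lsmul ℂ ℂ V) P hP u

end envelopingAlgebra

namespace LocalizedSymmetric

/-! ### The symmetric algebra of `g` with an inverse of `c ∈ g`

The ring `ℂ[g][T]`, on which `g` acts by derivations as it does on `S(g)[c⁻¹]` with `T = c⁻¹`. -/

attribute [local instance] LieRing.ofAssociativeRing

variable (g : Type*) [LieRing g] [LieAlgebra ℂ g] [FiniteDimensional ℂ g]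

/-- Polynomials on the dual of `g`, with one more variable `T`. -/
abbrev Poly : Type := MvPolynomial (Option (Fin (Module.finrank ℂ g))) ℂ

variable {g}

/-- The inclusion of `g` into the symmetric algebra. -/
def sym : g →ₗ[ℂ] Poly g := (Module.finBasis ℂ g).constr ℂ fun i ↦ MvPolynomial.X (some i)

/-- The variable `T`. -/
def T : Poly g := MvPolynomial.X none

/-- The derivation by which `Y ∈ g` acts. -/
def D (c Y : g) : Derivation ℂ (Poly g) (Poly g) :=
  MvPolynomial.mkDerivation ℂ fun j ↦ match j with
    | none => -(T * T * sym ⁅Y, c⁆)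
    | some i => sym ⁅Y, Module.finBasis ℂ g i⁆

@[simp] lemma D_T (c Y : g) : D c Y T = -(T * T * sym ⁅Y, c⁆) := by
  simp [D, T, MvPolynomial.mkDerivation_X]

@[simp] lemma D_sym (c Y x : g) : D c Y (sym x) = sym ⁅Y, x⁆ := by
  have : (D c Y).toLinearMap ∘ₗ sym = sym ∘ₗ LieAlgebra.ad ℂ g Y := by
    refine (Module.finBasis ℂ g).ext fun i ↦ ?_
    simp [sym, D, MvPolynomial.mkDerivation_X]
  exact LinearMap.congr_fun this x

lemma derivation_ext {E E' : Derivation ℂ (Poly g) (Poly g)} (h : E T = E' T)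
    (h' : ∀ x, E (sym x) = E' (sym x)) : E = E' := by
  refine MvPolynomial.derivation_ext fun j ↦ ?_
  cases j with
  | none => exact h
  | some i => simpa [sym] using h' (Module.finBasis ℂ g i)

/-- The action of `g` by derivations. -/
def action (c : g) : g →ₗ⁅ℂ⁆ Module.End ℂ (Poly g) where
  toFun Y := (D c Y).toLinearMap
  map_add' Y Z := by
    rw [show D c (Y + Z) = D c Y + D c Z from derivation_ext (by simp; ring) (by simp)]
    rfl
  map_smul' t Y := by
    rw [show D c (t • Y) = t • D c Y from derivation_ext (by simp) (by simp)]
    rfl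
  map_lie' {Y Z} := by
    have : D c ⁅Y, Z⁆ = ⁅D c Y, D c Z⁆ := by
      refine derivation_ext ?_ fun x ↦ ?_
      · rw [Derivation.commutator_apply]
        simp [-lie_skew]
        ring
      · rw [Derivation.commutator_apply]
        simp [-lie_skew]
    rw [this]
    rfl

@[simp] lemma lift_action_ι (c x : g) (P : Poly g) :
    UniversalEnvelopingAlgebra.lift ℂ (action c) (UniversalEnvelopingAlgebra.ι ℂ x) P =
      D c x P := by
  rw [UniversalEnvelopingAlgebra.lift_ι_apply]
  rfl

/-- The ideal generated by `T c - 1`. -/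
def relIdeal (c : g) : Ideal (Poly g) := Ideal.span {T * sym c - 1}

/-- The derivation of `x` sends `T c - 1` to `-T ⁅x, c⁆ (T c - 1)`, which explains the witness.
Working modulo this stable ideal replaces the construction of S(g)[c⁻¹]. -/
lemma lift_action_mem (c : g) (u : UniversalEnvelopingAlgebra ℂ g) {P : Poly g}
    (hP : P ∈ relIdeal c) : UniversalEnvelopingAlgebra.lift ℂ (action c) u P ∈ relIdeal c := by
  refine UniversalEnvelopingAlgebra.map_mem (UniversalEnvelopingAlgebra.lift ℂ (action c))
    ((relIdeal c).restrictScalars ℂ) (fun x m hm ↦ ?_) u P hP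
  obtain ⟨a, rfl⟩ := Ideal.mem_span_singleton'.mp hm
  rw [lift_action_ι]
  refine Ideal.mem_span_singleton'.mpr ⟨D c x a - a * T * sym ⁅x, c⁆, ?_⟩
  simp
  ring

/-- Evaluation at a linear form on `g`, with `T ↦ 1`. -/
def eval (p : g →ₗ[ℂ] ℂ) : Poly g →ₐ[ℂ] ℂ :=
  MvPolynomial.aeval fun j ↦ j.elim 1 fun i ↦ p (Module.finBasis ℂ g i)

@[simp] lemma eval_T (p : g →ₗ[ℂ] ℂ) : eval p T = 1 := by simp [eval, T]

@[simp] lemma eval_sym (p : g →ₗ[ℂ] ℂ) (x : g) : eval p (sym x) = p x := by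
  have : (eval p).toLinearMap ∘ₗ sym = p := by
    refine (Module.finBasis ℂ g).ext fun i ↦ ?_
    simp [sym, eval]
  exact LinearMap.congr_fun this x

lemma eval_eq_zero {p : g →ₗ[ℂ] ℂ} {c : g} (hp : p c = 1) {P : Poly g} (hP : P ∈ relIdeal c) :
    eval p P = 0 := by
  obtain ⟨a, rfl⟩ := Ideal.mem_span_singleton'.mp hP
  simp [hp]

lemma eval_D_D_T (p : g →ₗ[ℂ] ℂ) (c x y : g) :
    eval p (D c x (D c y T)) = 2 * p ⁅x, c⁆ * p ⁅y, c⁆ - p ⁅x, ⁅y, c⁆⁆ := by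
  simp [-lie_skew]
  ring

/-- With the iterated brackets invisible to `p`, only the third derivative of 1/t at t = 1, which is
-6, remains. -/
lemma eval_D_D_D_T (p : g →ₗ[ℂ] ℂ) (c x y z : g) (h1 : p ⁅x, ⁅y, c⁆⁆ = 0) (h2 : p ⁅x, ⁅z, c⁆⁆ = 0)
    (h3 : p ⁅y, ⁅z, c⁆⁆ = 0) (h4 : p ⁅x, ⁅y, ⁅z, c⁆⁆⁆ = 0) :
    eval p (D c x (D c y (D c z T))) = -6 * (p ⁅x, c⁆ * p ⁅y, c⁆ * p ⁅z, c⁆) := by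
  simp [-lie_skew, h1, h2, h3, h4]
  ring

end LocalizedSymmetric

namespace HeisenbergD4

attribute [local instance] LieRing.ofAssociativeRing

open UniversalEnvelopingAlgebra (ι)
open LocalizedSymmetric

/-! ### The vector ω₃(f₁) ⊗ 1 is non-zero -/

section nonvanishing

variable {g : Type*} [LieRing g] [LieAlgebra ℂ g] {H : LieSubalgebra ℂ g}
  {b : LieAlgebra.Basis (Fin 4) H} [FiniteDimensional ℂ g] [LieAlgebra.IsSimple ℂ g]
  (hA : b.A = CartanMatrix.D 4)

include hA in
lemma lie_Xgamma {x : g} (hx : x ∈ q b) : ⁅x, Xgamma b⁆ = B b x (Hgamma b) • Xgamma b := by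
  induction hx using LieSubalgebra.lieSpan_induction with
  | zero => simp
  | add u v _ _ hu hv => simp [hu, hv, add_smul]
  | smul t u _ hu => simp [hu, mul_smul]
  | lie u v hu' hv' hu hv =>
    have : B b ⁅u, v⁆ (Hgamma b) = 0 := by
      simp [B, killingForm_lie_Hgamma (mem_grade_of_mem_q hA hu') (mem_grade_of_mem_q hA hv')]
    rw [lie_lie, hu, hv, lie_smul, lie_smul, hu, hv, this, smul_comm, sub_self, zero_smul]
  | mem u hu =>
    rcases hu with (hu | ⟨i, rfl⟩) | ⟨i, hi, rfl⟩
    · have hu' : u ∈ Submodule.span ℂ (Set.range b.h) := by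
        rw [← b.coe_cartan_eq_span]; exact hu
      clear hu
      induction hu' using Submodule.span_induction with
      | zero => simp
      | add u v _ _ hu hv => simp [hu, hv, add_smul]
      | smul t u _ hu => simp [hu, mul_smul]
      | mem v hv =>
        obtain ⟨i, rfl⟩ := hv
        rw [lie_h_Xgamma hA, B_h_Hgamma hA]
    · have : B b (b.e i) (Hgamma b) = 0 := by
        by_cases hi : i = 1
        · subst hi
          exact B_Hgamma_of_mem_grade one_ne_zero (X_mem_grade hA (false, false, false))
        · exact B_e_Hgamma hA hi
      rw [lie_e_Xgamma hA, this, zero_smul]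
    · have hi : i ≠ 1 := by
        rintro rfl
        rw [lie_e hA] at hi
        exact (b.sl2 1).e_ne_zero (by simpa using hi)
      rw [lie_f_Xgamma hA, if_neg hi, B_f_Hgamma hA hi, zero_smul]

/-- The identification of `ℂ_{sλ}` with `ℂ` as a vector space. -/
def _root_.ScalarModule.coord {q : LieSubalgebra ℂ g} (s : ℂ) (lam : LieAlgebra.LieCharacter ℂ q) :
    ScalarModule s lam →ₗ[ℂ] ℂ :=
  (LinearMap.id : ℂ →ₗ[ℂ] ℂ)

/-- The map u ⊗ 1 ↦ u · T respects the relations of M modulo `relIdeal`, because T stands for X_γ⁻¹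
and q scales X_γ by dχ. Evaluation at `p` kills the ideal. -/
lemma eval_lift_action_eq_zero {p : g →ₗ[ℂ] ℂ} (hp : p (Xgamma b) = 1)
    {u : UniversalEnvelopingAlgebra ℂ g} (hu : u • vac hA = 0) :
    eval p (UniversalEnvelopingAlgebra.lift ℂ (action (Xgamma b)) u T) = 0 := by
  set φ := UniversalEnvelopingAlgebra.lift ℂ (action (Xgamma b)) with hφ
  let c := ScalarModule.coord (-1) (dchi b hA)
  have hc (a : q b) (f) : c ⁅a, f⁆ = (-1 * B b a (Hgamma b)) * c f := rfl
  let Ψ : UniversalEnvelopingAlgebra ℂ g ⊗[ℂ] ScalarModule (-1) (dchi b hA) →ₗ[ℂ]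
      LocalizedSymmetric.Poly g :=
    TensorProduct.lift (LinearMap.mk₂ ℂ (fun u f ↦ c f • φ u T)
      (fun u u' f ↦ by rw [map_add, LinearMap.add_apply, smul_add])
      (fun t u f ↦ by rw [map_smul, LinearMap.smul_apply, smul_comm])
      (fun u f f' ↦ by rw [map_add, add_smul])
      (fun t u f ↦ by rw [map_smul, smul_eq_mul, mul_smul]))
  have hΨ (u : UniversalEnvelopingAlgebra ℂ g) (f) : Ψ (u ⊗ₜ[ℂ] f) = c f • φ u T := rfl
  have hΨ' (u : UniversalEnvelopingAlgebra ℂ g) (t) : Ψ (u • t) = φ u (Ψ t) := by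
    induction t using TensorProduct.induction_on with
    | zero => simp
    | add x y hx hy => rw [smul_add, map_add, hx, hy, map_add, map_add]
    | tmul v f =>
      rw [TensorProduct.smul_tmul', hΨ, hΨ, smul_eq_mul, map_mul, map_smul, Module.End.mul_apply]
  have hmem {t} (ht : t ∈ genVermaRel (q b) (ScalarModule (-1) (dchi b hA))) :
      Ψ t ∈ relIdeal (Xgamma b) := by
    induction ht using Submodule.span_induction with
    | zero => simp
    | add x y _ _ hx hy => rw [map_add]; exact add_mem hx hy
    | smul u x _ hx => rw [hΨ']; exact lift_action_mem _ u hx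
    | mem t ht =>
      obtain ⟨u, a, f, rfl⟩ := ht
      have h1 : Ψ ((u * ι ℂ (a : g)) ⊗ₜ[ℂ] f - u ⊗ₜ[ℂ] ⁅a, f⁆) =
          φ u (c f • (D (Xgamma b) a T - (-1 * B b a (Hgamma b)) • T)) := by
        rw [map_sub, hΨ, hΨ, hc, map_mul, Module.End.mul_apply, hφ, lift_action_ι, map_smul,
          map_sub, map_smul]
        module
      rw [h1]
      refine lift_action_mem _ u ?_
      rw [D_T, lie_Xgamma hA a.2, map_smul]
      -- Indeed a · T + dχ(a) T = -dχ(a) T (T X_γ - 1).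
      refine Ideal.mem_span_singleton'.mpr ⟨MvPolynomial.C (-(c f * B b a (Hgamma b))) * T, ?_⟩
      simp only [MvPolynomial.smul_eq_C_mul, map_neg, map_mul, map_one]
      ring
  have h0 : u ⊗ₜ[ℂ] ScalarModule.one (-1) (dchi b hA) ∈
      genVermaRel (q b) (ScalarModule (-1) (dchi b hA)) := by
    rw [← mk_one_eq] at hu
    exact (Submodule.Quotient.mk_eq_zero _).mp hu
  have h2 := eval_eq_zero hp (hmem h0)
  rw [hΨ, show c (ScalarModule.one (-1) (dchi b hA)) = 1 from rfl, one_smul] at h2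
  exact h2

omit [FiniteDimensional ℂ g] [LieAlgebra.IsSimple ℂ g] in
lemma lie_mem_grade_of_eq {x y : g} {i j k : ℤ} (h : i + j = k) (hx : x ∈ grade b i)
    (hy : y ∈ grade b j) : ⁅x, y⁆ ∈ grade b k :=
  h ▸ lie_mem_grade hx hy

/-- A linear form that vanishes on the `g(k)` with `k ≤ 0` and singles out the monomial
`X_{-α₁-α₀} X_{-α₁-α₂} X_{-α₁-α₃}` of `ω₃(f 1)`. -/
def probe (b : LieAlgebra.Basis (Fin 4) H) : g →ₗ[ℂ] ℂ :=
  (B b).flip (XnegGamma b + X b.symm (false, true, true) + X b.symm (true, false, true) +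
    X b.symm (true, true, false))

omit [FiniteDimensional ℂ g] [LieAlgebra.IsSimple ℂ g] in
lemma probe_apply (x : g) : probe b x = B b x (XnegGamma b) + B b x (X b.symm (false, true, true)) +
    B b x (X b.symm (true, false, true)) + B b x (X b.symm (true, true, false)) := by
  change B b x _ = _
  simp only [map_add]

omit [FiniteDimensional ℂ g] [LieAlgebra.IsSimple ℂ g] in
include hA in
lemma probe_of_mem_grade {k : ℤ} (hk : k ≤ 0) {x : g} (hx : x ∈ grade b k) : probe b x = 0 := by
  have h1 (ε) : B b x (X b.symm ε) = 0 :=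
    B_eq_zero_of_grade (by omega) hx (X_symm_mem_grade hA ε)
  have h2 : B b x (XnegGamma b) = 0 :=
    B_eq_zero_of_grade (by omega) hx (XnegGamma_mem_grade hA)
  simp [probe_apply, h1, h2]

include hA in
lemma probe_Xgamma : probe b (Xgamma b) = 1 := by
  have h1 (ε) : B b (Xgamma b) (X b.symm ε) = 0 :=
    B_eq_zero_of_grade (by decide) (Xgamma_mem_grade hA) (X_symm_mem_grade hA ε)
  simp [probe_apply, h1, B_Xgamma_XnegGamma hA]

include hA in
-- The bracket pairs only with the vector of the complementary index, with value minus the sign of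
-- (p, q, r). The three complements present in `probe` belong to the roots α₁ + α_i, whose sign is
-- -1.
lemma probe_lie_Xgamma (p q r : Bool) : probe b ⁅X b.symm (p, q, r), Xgamma b⁆ =
    if (p, q, r) ∈ [(true, false, false), (false, true, false), (false, false, true)]
    then 1 else 0 := by
  have h1 (p' q' r' : Bool) : B b ⁅X b.symm (p, q, r), Xgamma b⁆ (X b.symm (p', q', r')) =
      if p' = !p ∧ q' = !q ∧ r' = !r then -sign (p, q, r) else 0 := by
    have := B_lie_right (b := b) (Xgamma b) (X b.symm (p, q, r)) (X b.symm (p', q', r'))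
    rw [← neg_eq_iff_eq_neg] at this
    rw [← this, lie_X_X_symm hA]
    split_ifs <;> simp [B_Xgamma_XnegGamma hA]
  have h2 : B b ⁅X b.symm (p, q, r), Xgamma b⁆ (XnegGamma b) = 0 :=
    B_eq_zero_of_grade (i := 1) (by norm_num)
      (lie_mem_grade_of_eq (by norm_num) (X_symm_mem_grade hA (p, q, r)) (Xgamma_mem_grade hA))
      (XnegGamma_mem_grade hA)
  rw [probe_apply, h1, h1, h1, h2]
  cases p <;> cases q <;> cases r <;> simp [sign]

/-- Every monomial of the cubic but the last starts with X_{-α₁} and evaluates to 0. The last one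
gives (3/2)(-2)(-6) = 18. -/
lemma omega3_f_one_smul_vac_ne_zero : omega3 b (b.f 1) • vac hA ≠ 0 := by
  intro h
  have h0 := eval_lift_action_eq_zero hA (probe_Xgamma hA) h
  have hX (ε) : X b.symm ε ∈ grade b (-1) := X_symm_mem_grade hA ε
  have hF : XnegGamma b ∈ grade b (-2) := XnegGamma_mem_grade hA
  have hG := Xgamma_mem_grade hA (b := b)
  have g1 (ε) : ⁅X b.symm ε, Xgamma b⁆ ∈ grade b 1 := lie_mem_grade_of_eq (by norm_num) (hX ε) hG
  have g2 (ε δ) : ⁅X b.symm ε, ⁅X b.symm δ, Xgamma b⁆⁆ ∈ grade b 0 :=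
    lie_mem_grade_of_eq (by norm_num) (hX ε) (g1 δ)
  have g3 (ε δ η) : ⁅X b.symm ε, ⁅X b.symm δ, ⁅X b.symm η, Xgamma b⁆⁆⁆ ∈ grade b (-1) :=
    lie_mem_grade_of_eq (by norm_num) (hX ε) (g2 δ η)
  have g4 : ⁅XnegGamma b, Xgamma b⁆ ∈ grade b 0 := lie_mem_grade_of_eq (by norm_num) hF hG
  have g5 (ε) : ⁅X b.symm ε, ⁅XnegGamma b, Xgamma b⁆⁆ ∈ grade b (-1) :=
    lie_mem_grade_of_eq (by norm_num) (hX ε) g4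
  have e3 (ε δ η) := eval_D_D_D_T (probe b) (Xgamma b) (X b.symm ε) (X b.symm δ) (X b.symm η)
    (probe_of_mem_grade hA le_rfl (g2 ε δ)) (probe_of_mem_grade hA le_rfl (g2 ε η))
    (probe_of_mem_grade hA le_rfl (g2 δ η)) (probe_of_mem_grade hA (by norm_num) (g3 ε δ η))
  have e2 (ε) := eval_D_D_T (probe b) (Xgamma b) (X b.symm ε) (XnegGamma b)
  have p4 : probe b ⁅XnegGamma b, Xgamma b⁆ = 0 := probe_of_mem_grade hA le_rfl g4
  have p5 (ε) : probe b ⁅X b.symm ε, ⁅XnegGamma b, Xgamma b⁆⁆ = 0 :=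
    probe_of_mem_grade hA (by norm_num) (g5 ε)
  simp only [p4, p5, mul_zero, sub_zero] at e2
  simp only [probe_lie_Xgamma hA] at e3
  rw [omega3_f_one hA] at h0
  simp only [map_smul, map_add, map_sub, map_mul, LinearMap.smul_apply, LinearMap.add_apply,
    LinearMap.sub_apply, Module.End.mul_apply, lift_action_ι, e2, e3] at h0
  norm_num at h0

end nonvanishing

end HeisenbergD4

/-! ### Homomorphisms out of a generalized Verma module -/

section genVerma

variable {g : Type*} [LieRing g] [LieAlgebra ℂ g] (q : LieSubalgebra ℂ g)
  {F : Type*} [AddCommGroup F] [Module ℂ F] [LieRingModule q F] [LieModule ℂ q F]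
  {V : Type*} [AddCommGroup V] [Module ℂ V] [Module (UniversalEnvelopingAlgebra ℂ g) V]
  [IsScalarTower ℂ (UniversalEnvelopingAlgebra ℂ g) V]

/-- The universal property of `U(g) ⊗_{U(q)} F`. -/
def GenVerma.lift (f : F →ₗ[ℂ] V)
    (hf : ∀ (a : q) (m : F), f ⁅a, m⁆ = UniversalEnvelopingAlgebra.ι ℂ (a : g) • f m) :
    GenVerma q F →ₗ[UniversalEnvelopingAlgebra ℂ g] V :=
  (genVermaRel q F).liftQ
    (TensorProduct.AlgebraTensorModule.lift
      (LinearMap.toSpanSingleton (UniversalEnvelopingAlgebra ℂ g) (F →ₗ[ℂ] V) f)) <| by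
    refine Submodule.span_le.mpr ?_
    rintro _ ⟨u, a, m, rfl⟩
    simp [hf, mul_smul]

end genVerma

namespace HeisenbergD4

attribute [local instance] LieRing.ofAssociativeRing

open UniversalEnvelopingAlgebra (ι)

/-! ### The dimension of E, and a proper submodule -/

section reducibility

variable {g : Type*} [LieRing g] [LieAlgebra ℂ g] {H : LieSubalgebra ℂ g}
  {b : LieAlgebra.Basis (Fin 4) H} (hA : b.A = CartanMatrix.D 4)

/-- The `q`-submodule `E` of `M(ℂ_{-dχ})`. -/
def omega3Submodule [FiniteDimensional ℂ g] [LieAlgebra.IsSimple ℂ g] :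
    LieSubmodule ℂ (q b) (M b hA) where
  __ := omega3Span b hA
  lie_mem {x _} hm := lie_mem_omega3Span hA x.2 hm

lemma exists_omega3_of_mem_omega3Span {m : M b hA} (hm : m ∈ omega3Span b hA) :
    ∃ Y ∈ grade b (-1), m = omega3 b Y • vac hA := by
  induction hm using Submodule.span_induction with
  | zero =>
    refine ⟨0, zero_mem _, ?_⟩
    rw [← zero_smul ℂ (0 : g), omega3_smul, zero_smul, zero_smul]
  | add x y _ _ hx hy =>
    obtain ⟨Y, hY, rfl⟩ := hx
    obtain ⟨Z, hZ, rfl⟩ := hy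
    exact ⟨Y + Z, add_mem hY hZ, by rw [omega3_add, add_smul]⟩
  | smul t x _ hx =>
    obtain ⟨Y, hY, rfl⟩ := hx
    exact ⟨t • Y, Submodule.smul_mem _ t hY, by rw [omega3_smul, smul_assoc]⟩
  | mem m hm => obtain ⟨Y, hY, rfl⟩ := hm; exact ⟨Y, hY, mk_one_eq hA _⟩

lemma finiteDimensional_omega3Span [FiniteDimensional ℂ g] :
    FiniteDimensional ℂ (omega3Span b hA) := by
  let f : g →ₗ[ℂ] M b hA :=
    { toFun := fun Y ↦ omega3 b Y • vac hA
      map_add' := fun Y Z ↦ by rw [omega3_add, add_smul]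
      map_smul' := fun t Y ↦ by rw [omega3_smul, smul_assoc, RingHom.id_apply] }
  refine Submodule.finiteDimensional_of_le (S₂ := LinearMap.range f) fun m hm ↦ ?_
  obtain ⟨Y, -, rfl⟩ := exists_omega3_of_mem_omega3Span hA hm
  exact ⟨Y, rfl⟩

include hA in
lemma f_one_mem_grade : b.f 1 ∈ grade b (-1) := X_symm_mem_grade hA (false, false, false)

lemma Hgamma_mem_q : Hgamma b ∈ q b := by
  have h := h_mem_q (b := b)
  exact add_mem (add_mem (add_mem (h 0) (Submodule.smul_mem (q b).toSubmodule 2 (h 1))) (h 2)) (h 3)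

include hA in
lemma gradeGen_subset_q {k : ℤ} (hk : 0 ≤ k) : gradeGen b k ⊆ q b := by
  have hX (ε : RootIdx) : X b ε ∈ q b := by
    have he := e_mem_q (b := b)
    obtain ⟨p, q, r⟩ := ε
    cases p <;> cases q <;> cases r
    exacts [he 1, LieSubalgebra.lie_mem _ (he 3) (he 1), LieSubalgebra.lie_mem _ (he 2) (he 1),
      LieSubalgebra.lie_mem _ (he 2) (LieSubalgebra.lie_mem _ (he 3) (he 1)), LieSubalgebra.lie_mem _ (he 0) (he 1),
      LieSubalgebra.lie_mem _ (he 0) (LieSubalgebra.lie_mem _ (he 3) (he 1)), LieSubalgebra.lie_mem _ (he 0) (LieSubalgebra.lie_mem _ (he 2) (he 1)),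
      LieSubalgebra.lie_mem _ (he 0) (LieSubalgebra.lie_mem _ (he 2) (LieSubalgebra.lie_mem _ (he 3) (he 1)))]
  intro x hx
  rw [gradeGen] at hx
  split_ifs at hx with h1 h2 h3 h4 h5
  · rw [Set.mem_singleton_iff.mp hx]
    exact LieSubalgebra.lie_mem _ (e_mem_q 1) (hX _)
  · obtain ⟨ε, rfl⟩ := hx
    exact hX ε
  · rcases hx with (⟨i, rfl⟩ | ⟨i, hi, rfl⟩) | ⟨i, hi, rfl⟩
    · exact h_mem_q i
    · exact e_mem_q i
    · exact f_mem_q hA hi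
  · omega
  · omega
  · exact hx.elim

variable [FiniteDimensional ℂ g] [LieAlgebra.IsSimple ℂ g]

/-- For the sl₂ of α₀, w is killed by `e 0` and has weight 1, so `e 0` takes `f 0` w back to w ≠ 0.
If E were a line, `e 0` would kill all of it. -/
lemma one_lt_finrank_omega3Submodule : 1 < Module.finrank ℂ (omega3Submodule hA) := by
  by_contra hle
  -- An infinite-dimensional space has `finrank` 0, so finiteness is needed before a spanning vector
  -- can be extracted.
  have : FiniteDimensional ℂ (omega3Submodule hA) := finiteDimensional_omega3Span hA
  obtain ⟨v, hv⟩ := finrank_le_one_iff.mp (not_lt.mp hle)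
  set w := omega3 b (b.f 1) • vac hA with hw
  have hwE : w ∈ omega3Submodule hA := omega3_smul_mem hA (f_one_mem_grade hA)
  have hfE : ⁅b.f 0, w⁆ ∈ omega3Submodule hA :=
    lie_mem_omega3Span hA (f_mem_q hA (by decide)) hwE
  obtain ⟨s, hs⟩ := hv ⟨w, hwE⟩
  obtain ⟨t, ht⟩ := hv ⟨⁅b.f 0, w⁆, hfE⟩
  replace hs : s • (v : M b hA) = w := congrArg Subtype.val hs
  replace ht : t • (v : M b hA) = ⁅b.f 0, w⁆ := congrArg Subtype.val ht
  have hs0 : s ≠ 0 := by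
    rintro rfl
    exact omega3_f_one_smul_vac_ne_zero hA (by rw [← hw, ← hs, zero_smul])
  have he : ⁅b.e 0, w⁆ = 0 := by
    rw [hw, (isLevi_e hA (by decide : (0 : Fin 4) ≠ 1)).lie_omega3_smul_vac hA (e_mem_q 0),
      B_e_Hgamma hA (by decide), b.lie_e_f_ne _ _ (by decide)]
    rw [← zero_smul ℂ (0 : g), omega3_smul]
    simp
  have hh : ⁅b.h 0, w⁆ = w := by
    rw [hw, (isLevi_h hA 0).lie_omega3_smul_vac hA (h_mem_q 0), B_h_Hgamma hA, b.lie_h_f, hA]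
    simp [CartanMatrix.D]
  have hv0 : ⁅b.e 0, (v : M b hA)⁆ = 0 := by
    have := congrArg (fun m ↦ ⁅b.e 0, m⁆) hs
    simpa [he, hs0] using this
  have := congrArg (fun m ↦ ⁅b.e 0, m⁆) ht
  simp only [lie_smul, hv0, smul_zero, leibniz_lie (b.e 0), he, lie_zero, add_zero, (b.sl2 0).lie_e_f,
    hh] at this
  exact omega3_f_one_smul_vac_ne_zero hA this.symm

/-- The eigenvalue is -1 - 2 · 2: the degree of `Y`, and twice dχ(H_γ) = 2. -/
lemma lie_Hgamma_omega3_smul_vac {Y : g} (hY : Y ∈ grade b (-1)) :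
    ⁅Hgamma b, omega3 b Y • vac hA⁆ = (-5 : ℂ) • omega3 b Y • vac hA := by
  have hT (i : Fin 4) : ⁅b.h i, omega3 b Y • vac hA⁆ =
      (omega3 b ⁅b.h i, Y⁆ - (2 * if i = 1 then 1 else 0 : ℂ) • omega3 b Y) • vac hA := by
    rw [← B_h_Hgamma hA]
    exact (isLevi_h hA i).lie_omega3_smul_vac hA (h_mem_q i) Y
  have h1 : omega3 b ⁅Hgamma b, Y⁆ = (-1 : ℂ) • omega3 b Y := by
    rw [← omega3_smul]
    simp only [grade, Module.End.mem_eigenspace_iff, LieAlgebra.ad_apply] at hY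
    rw [hY]
    norm_num
  simp only [Hgamma, add_lie, smul_lie, omega3_add, omega3_smul] at h1
  simp only [Hgamma, add_lie, smul_lie, hT]
  simp only [reduceIte, (by decide : (0 : Fin 4) ≠ 1), (by decide : (2 : Fin 4) ≠ 1),
    (by decide : (3 : Fin 4) ≠ 1)]
  generalize omega3 b Y = W at h1 ⊢
  generalize omega3 b ⁅b.h 0, Y⁆ = W₀ at h1 ⊢
  generalize omega3 b ⁅b.h 1, Y⁆ = W₁ at h1 ⊢
  generalize omega3 b ⁅b.h 2, Y⁆ = W₂ at h1 ⊢
  generalize omega3 b ⁅b.h 3, Y⁆ = W₃ at h1 ⊢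
  have h2 : W₃ = (-1 : ℂ) • W - (W₀ + (2 : ℂ) • W₁ + W₂) := by rw [← h1]; abel
  subst h2
  generalize vac hA = v
  simp only [sub_smul, add_smul, smul_assoc]
  generalize W • v = w
  generalize W₀ • v = w₀
  generalize W₁ • v = w₁
  generalize W₂ • v = w₂
  module

/-- The `U(n̄)`-submodule generated by `E`. -/
def nbarSpan : Submodule ℂ (M b hA) :=
  sInf {P | omega3Span b hA ≤ P ∧ ∀ k : ℤ, k < 0 → ∀ x ∈ grade b k, ∀ m ∈ P, ⁅x, m⁆ ∈ P}

omit [FiniteDimensional ℂ g] [LieAlgebra.IsSimple ℂ g] in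
lemma nbarSpan_le {P : Submodule ℂ (M b hA)} (h : omega3Span b hA ≤ P)
    (h' : ∀ k : ℤ, k < 0 → ∀ x ∈ grade b k, ∀ m ∈ P, ⁅x, m⁆ ∈ P) : nbarSpan hA ≤ P :=
  sInf_le ⟨h, h'⟩

omit [FiniteDimensional ℂ g] [LieAlgebra.IsSimple ℂ g] in
lemma omega3Span_le_nbarSpan : omega3Span b hA ≤ nbarSpan hA :=
  le_sInf fun _ hP ↦ hP.1

omit [FiniteDimensional ℂ g] [LieAlgebra.IsSimple ℂ g] in
lemma lie_mem_nbarSpan_of_neg {k : ℤ} (hk : k < 0) {x : g} (hx : x ∈ grade b k) {m : M b hA}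
    (hm : m ∈ nbarSpan hA) : ⁅x, m⁆ ∈ nbarSpan hA :=
  Submodule.mem_sInf.mpr fun _ hP ↦ hP.2 k hk x hx m (Submodule.mem_sInf.mp hm _ hP)

/-- The vectors that all of `g` maps into the span form a subspace containing E, since q preserves
E. It is stable under n̄ by ⁅x, ⁅y, m⁆⁆ = ⁅⁅x, y⁆, m⁆ + ⁅y, ⁅x, m⁆⁆, so minimality of the span
applies. -/
lemma lie_mem_nbarSpan (x : g) {m : M b hA} (hm : m ∈ nbarSpan hA) : ⁅x, m⁆ ∈ nbarSpan hA := by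
  let Q : Submodule ℂ (M b hA) :=
    { carrier := {m | m ∈ nbarSpan hA ∧ ∀ x : g, ⁅x, m⁆ ∈ nbarSpan hA}
      zero_mem' := ⟨zero_mem _, fun x ↦ by rw [lie_zero]; exact zero_mem _⟩
      add_mem' := fun h h' ↦ ⟨add_mem h.1 h'.1, fun x ↦ by
        rw [lie_add]; exact add_mem (h.2 x) (h'.2 x)⟩
      smul_mem' := fun t m h ↦ ⟨Submodule.smul_mem _ t h.1, fun x ↦ by
        rw [lie_smul]; exact Submodule.smul_mem _ t (h.2 x)⟩ }
  have hQ : nbarSpan hA ≤ Q := by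
    refine nbarSpan_le hA (fun m hm ↦ ⟨omega3Span_le_nbarSpan hA hm, fun x ↦ ?_⟩)
      fun k hk y hy m hm ↦ ⟨lie_mem_nbarSpan_of_neg hA hk hy hm.1, fun x ↦ ?_⟩
    · have hx : x ∈ Submodule.span ℂ (⋃ k, gradeGen b k) := by rw [span_gradeGen hA]; trivial
      induction hx using Submodule.span_induction with
      | zero => simp
      | add x y _ _ hx hy => rw [add_lie]; exact add_mem hx hy
      | smul t x _ hx => rw [smul_lie]; exact Submodule.smul_mem _ t hx
      | mem x hx =>
        obtain ⟨k, hx⟩ := Set.mem_iUnion.mp hx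
        rcases lt_or_ge k 0 with hk | hk
        · exact lie_mem_nbarSpan_of_neg hA hk (gradeGen_subset_grade hA k hx)
            (omega3Span_le_nbarSpan hA hm)
        · exact omega3Span_le_nbarSpan hA (lie_mem_omega3Span hA (gradeGen_subset_q hA hk hx) hm)
    · rw [leibniz_lie]
      exact add_mem (hm.2 _) (lie_mem_nbarSpan_of_neg hA hk hy (hm.2 x))
  exact (hQ hm).2 x

lemma nbarSpan_le_iSup_eigenspace : nbarSpan hA ≤
    ⨆ k : ℕ, (LieModule.toEnd ℂ g (M b hA) (Hgamma b)).eigenspace (-5 - (k : ℂ)) := by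
  refine nbarSpan_le hA (fun m hm ↦ ?_) fun k hk x hx m hm ↦ ?_
  · obtain ⟨Y, hY, rfl⟩ := exists_omega3_of_mem_omega3Span hA hm
    refine Submodule.mem_iSup_of_mem 0 ?_
    rw [Module.End.mem_eigenspace_iff, LieModule.toEnd_apply_apply,
      lie_Hgamma_omega3_smul_vac hA hY, Nat.cast_zero, sub_zero]
  · induction hm using Submodule.iSup_induction' with
    | zero => simp
    | add m m' _ _ h h' => rw [lie_add]; exact add_mem h h'
    | mem j m hm =>
      refine Submodule.mem_iSup_of_mem (j + k.natAbs) ?_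
      simp only [grade, Module.End.mem_eigenspace_iff, LieAlgebra.ad_apply,
        LieModule.toEnd_apply_apply] at hm hx ⊢
      rw [leibniz_lie, hm, hx, smul_lie, lie_smul, ← add_smul]
      congr 1
      have : (k : ℂ) = -(k.natAbs : ℂ) := by
        have : k = -(k.natAbs : ℤ) := by omega
        exact_mod_cast congrArg (Int.cast : ℤ → ℂ) this
      rw [this]
      push_cast
      ring

/-- The generator has H_γ-eigenvalue -2, which is not of the form -5 - k; independence of
eigenspaces would force it to be 0. -/
lemma vac_notMem_nbarSpan : vac hA ∉ nbarSpan hA := by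
  intro h
  have h1 : vac hA ∈ (LieModule.toEnd ℂ g (M b hA) (Hgamma b)).eigenspace (-2) := by
    rw [Module.End.mem_eigenspace_iff, LieModule.toEnd_apply_apply, lie_vac hA Hgamma_mem_q,
      B_Hgamma_Hgamma hA]
  have h2 : vac hA ∈ ⨆ μ, ⨆ (_ : μ ≠ (-2 : ℂ)),
      (LieModule.toEnd ℂ g (M b hA) (Hgamma b)).eigenspace μ := by
    refine (nbarSpan_le_iSup_eigenspace hA).trans (iSup_le fun k ↦ ?_) h
    refine le_iSup₂_of_le (-5 - (k : ℂ)) (fun hk ↦ ?_) le_rfl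
    have : ((k + 3 : ℕ) : ℂ) = 0 := by push_cast; linear_combination -hk
    exact absurd (Nat.cast_eq_zero.mp this) (by omega)
  have h3 := Module.End.eigenspaces_iSupIndep (LieModule.toEnd ℂ g (M b hA) (Hgamma b)) (-2)
  have h4 : vac hA = 0 := Submodule.disjoint_def.mp h3 _ h1 h2
  exact omega3_f_one_smul_vac_ne_zero hA (by rw [h4, smul_zero])

end reducibility

end HeisenbergD4

theorem mainTheorem2 {g : Type*} [LieRing g] [LieAlgebra ℂ g] [FiniteDimensional ℂ g]
    [LieAlgebra.IsSimple ℂ g] {H : LieSubalgebra ℂ g} (b : LieAlgebra.Basis (Fin 4) H)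
    (hA : b.A = CartanMatrix.D 4) :
    (∃ E : LieSubmodule ℂ (HeisenbergD4.q b) (HeisenbergD4.M b hA),
      E.toSubmodule = HeisenbergD4.omega3Span b hA ∧
      1 < Module.finrank ℂ E ∧
      (∀ x ∈ HeisenbergD4.n b, ∀ m ∈ E, ⁅x, m⁆ = 0) ∧
      ∃ φ : GenVerma (HeisenbergD4.q b) E →ₗ[UniversalEnvelopingAlgebra ℂ g]
          HeisenbergD4.M b hA,
        φ ≠ 0 ∧ ∀ (u : UniversalEnvelopingAlgebra ℂ g) (m : E),
          φ (GenVerma.mk (HeisenbergD4.q b) u m) = u • (m : HeisenbergD4.M b hA)) ∧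
    ∃ N : Submodule (UniversalEnvelopingAlgebra ℂ g) (HeisenbergD4.M b hA), N ≠ ⊥ ∧ N ≠ ⊤ := by
  have hw := HeisenbergD4.omega3_smul_mem hA (HeisenbergD4.f_one_mem_grade hA)
  have hw0 := HeisenbergD4.omega3_f_one_smul_vac_ne_zero hA
  obtain ⟨φ, hφ⟩ : ∃ φ : GenVerma (HeisenbergD4.q b) (HeisenbergD4.omega3Submodule hA)
      →ₗ[UniversalEnvelopingAlgebra ℂ g] HeisenbergD4.M b hA, ∀ u m,
        φ (GenVerma.mk (HeisenbergD4.q b) u m) = u • (m : HeisenbergD4.M b hA) :=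
    ⟨GenVerma.lift _ (HeisenbergD4.omega3Submodule hA).incl.toLinearMap (fun a m ↦ rfl),
      fun u m ↦ rfl⟩
  refine ⟨⟨HeisenbergD4.omega3Submodule hA, rfl, HeisenbergD4.one_lt_finrank_omega3Submodule hA,
    fun x hx m hm ↦ HeisenbergD4.lie_eq_zero_of_mem_n hA hx hm, φ, fun h ↦ hw0 ?_, hφ⟩,
    Submodule.span _ (HeisenbergD4.omega3Span b hA : Set (HeisenbergD4.M b hA)), fun h ↦ hw0 ?_,
    fun h ↦ HeisenbergD4.vac_notMem_nbarSpan hA ?_⟩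
  · have := hφ 1 ⟨_, hw⟩
    rw [h, LinearMap.zero_apply, one_smul] at this
    exact this.symm
  · exact (Submodule.mem_bot _).mp (h ▸ Submodule.subset_span hw)
  -- The U(g)-span of E stays inside the g-stable subspace `nbarSpan`, which misses the generator of
  -- M.
  · have hv {m} (hm : m ∈ Submodule.span (UniversalEnvelopingAlgebra ℂ g)
        (HeisenbergD4.omega3Span b hA : Set (HeisenbergD4.M b hA))) :
        m ∈ HeisenbergD4.nbarSpan hA := by
      induction hm using Submodule.span_induction with
      | zero => exact zero_mem _
      | add x y _ _ hx hy => exact add_mem hx hy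
      | smul u x _ hx =>
        exact UniversalEnvelopingAlgebra.smul_mem (HeisenbergD4.nbarSpan hA)
          (fun x m hm ↦ HeisenbergD4.lie_mem_nbarSpan hA x hm) u x hx
      | mem x hx => exact HeisenbergD4.omega3Span_le_nbarSpan hA hx
    exact hv (h ▸ Submodule.mem_top)

end
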